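/- \textbf{Setting.} A \emph{vtree} for a finite nonempty variable set $X$ is a full rooted binary tree, with left and right children, whose leaves are in bijection with $X$. For a node $v$, $\mathrm{vars}(v)$ is the set of variables below $v$, $T_v$ is the subtree of $T$ rooted at $v$, and $\mathrm{shell}(v)=X\setminus\mathrm{vars}(v)$. $T$ is \emph{normalized} if at each inner node $|\mathrm{vars}(v_\ell)|\le|\mathrm{vars}(v_r)|$. An NNF is a finite acyclic circuit with a root, with binary (left/right) $\wedge$-gates, unbounded fan-in $\vee$-gates, and leaves labeled by literals or constants; $\mathrm{vars}(u)$ is the set of variables occurring in the subcircuit $\mathcal D_u$ rooted at $u$, and $f_u$ is the function it represents. A \emph{structured d-DNNF with respect to $T$} is an NNF in which the children of each $\wedge$-gate have disjoint variable sets, the children of each $\vee$-gate represent pairwise disjoint functions, and every $\wedge$-gate $u$ with children $u_\ell,u_r$ respects some inner node $v$ of $T$, i.e. $\mathrm{vars}(u_\ell)\subseteq\mathrm{vars}(v_\ell)$ and $\mathrm{vars}(u_r)\subseteq\mathrm{vars}(v_r)$. The \emph{decomposition node} $\mathrm{d}(u)$ is the corresponding leaf for a literal, the lowest node respected by $u$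 for an $\wedge$-gate, and the common decomposition node of the children for an $\vee$-gate; constants have none. The circuit is \emph{smooth} if the children of each $\vee$-gate mention the same variables. It is \emph{simple} if there are no edges between $\vee$-gates, no $\vee$-gate has a constant as a child, and only nodes labeled $\bot$ represent $\bot$. An \emph{SDD respecting a vtree $T$} is, inductively: a constant; or a literal on a variable of $T$; or a disjunction of $\wedge$-gates with wires from $p_i$ and $s_i$ such that, for some inner node $v$ of $T$, the circuits rooted at the $p_i$ are SDDs respecting $T_{v_\ell}$, those rooted at the $s_i$ are SDDs respecting $T_{v_r}$, and the functions at the $p_i$ form a partition (each is satisfiable, they are pairwise disjoint, and their disjunction is $\top$). For an assignment $p$ to $\mathrm{shell}(v)$, let $\mathcal D_p$ be the circuit obtained by replacing these variables according to $p$, eliminating all gates that now compute $\bot$, and removing everything no longer connected to the root. $R(\mathcal D_p,v)$ is the set of nodes of $\mathcal D_p$ with decomposition node $v$, and $R^+(\mathcal D_p,v)$ is the set of those nodes in $R(\mathcal D_p,v)$ that have no child in $R(\mathcal D_p,v)$. \textbf{Hypotheses.} Let $T$ be a normalized vtree for $X$, and let $\mathcal D$, $\overline{\mathcal D}$, with node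 sets $V$, $\overline V$, be smooth and simple structured d-DNNFs with respect to $T$ representing $f$ and $\overline f$. All nodes are connected to the root, no constant is a child of an $\wedge$-gate, and each of the two circuits mentions all variables of $X$ unless it consists of a single constant. Put $Y=V\sqcup\overline V$. \textbf{The modified vtree $T'$.} Each inner node $v$ of $T$ with more than two variables gets a new parent $v'$, whose left child is $v$ and whose right child is a leaf with a new auxiliary variable. For $u\in Y$ with $v=\mathrm d(u)$ let $\mathrm{node}(u)=v$ if $u$ is an $\wedge$-gate or $|\mathrm{vars}(v)|\le 2$, and $\mathrm{node}(u)=v'$ otherwise. (For a constant $u$, any node of $T'$ may be taken.) \textbf{The circuit $S$.} \begin{enumerate} \item If $u\in Y$ is a constant or a literal, $(u,\emptyset)$ carries the same label. If $u$ is another node with $|\mathrm{vars}(\mathrm d(u))|\le 2$, then $(u,\emptyset)$ is the root of a chosen SDD for $f_u$ respecting $T_{\mathrm d(u)}$. In all other cases $(u,\emptyset)$ is an $\vee$-node. \item For an $\vee$-node $u$ with $v=\mathrm d(u)$ and $|\mathrm{vars}(v)|>2$, choose a shell restriction $p$ with respect to $v$ such that $u$ is in $R(\mathcal D_p,v)$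 (in $R(\overline{\mathcal D}_p,v)$ if $u\in\overline V$). The children of $(u,\emptyset)$ are $\wedge$-nodes $(u,u')$ for all $u'\in R^+(\mathcal D_p,v)\cup R^+(\overline{\mathcal D}_p,v)$. The left child of $(u,u')$ is $(u',\emptyset)$; its right child is a node labeled $\top$ if $u'$ is a child of $u$, and a node labeled $\bot$ otherwise. \item For an $\wedge$-node $u$ with children $u_\ell,u_r$ and $|\mathrm{vars}(\mathrm d(u))|>2$, let $v_\ell=\mathrm d(u_\ell)$ and choose a shell restriction $p$ with respect to $v_\ell$ such that $u_\ell$ is in $R(\mathcal D_p,v_\ell)$ (in $R(\overline{\mathcal D}_p,v_\ell)$ if $u\in\overline V$). The children of $(u,\emptyset)$ are an $\wedge$-node $(u,\wedge)$ with children $(u_\ell,\emptyset)$ and $(u_r,\emptyset)$, and, for each $u'\in R^+(\mathcal D_p,v_\ell)\cup R^+(\overline{\mathcal D}_p,v_\ell)$ other than $u_\ell$ and the children of $u_\ell$, an $\wedge$-node $(u,u')$ whose left child is $(u',\emptyset)$ and whose right child is labeled $\bot$. \item The root of $S$ is $(\mathrm{root}(\mathcal D),\emptyset)$, and all nodes not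 reachable from it are removed. \end{enumerate} \textbf{Statement.} All choices required by the construction are possible. Moreover, whatever choices are made: \begin{enumerate} \item[(a)] For every $u\in Y$ such that $(u,\emptyset)$ is a node of $S$, $\mathrm{node}(u)$ is a node of $T'$ and the subcircuit $S_{(u,\emptyset)}$ is a syntactically correct SDD respecting $T'_{\mathrm{node}(u)}$. It represents the same function as $\mathcal D_u$ (if $u\in V$) or $\overline{\mathcal D}_u$ (if $u\in\overline V$), regarded as a function that does not depend on the auxiliary variables. \item[(b)] $T'$ is a vtree for $X$ together with one auxiliary variable for each inner node of $T$ with more than two variables, and $S$ is a syntactically correct SDD respecting $T'$ that represents $f$. \end{enumerate} -/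

import Mathlib

namespace SDDSim

/-! ## Vtrees -/

/-- Full rooted binary trees (with distinguished left and right children) whose leaves carry
variables.  In a vtree no variable occurs twice, so distinct nodes are the roots of distinct
subtrees; a node of a vtree `T` is therefore represented by the subtree of `T` rooted at it. -/
inductive VTree (X : Type*) where
  | leaf (x : X) : VTree X
  | node (l r : VTree X) : VTree X

namespace VTree

variable {X : Type*}

/-- The labels of the leaves, from left to right. -/
def leaves : VTree X → List X
  | leaf x => [x]
  | node l r => l.leaves ++ r.leaves

/-- The set of variables of a vtree. -/
def vars (T : VTree X) : Set X := {x | x ∈ T.leaves}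

/-- The number of leaves; for a vtree this is the number of its variables. -/
def card (T : VTree X) : ℕ := T.leaves.length

/-- `T` is a vtree for the variable set `A`: the leaves are in one-to-one correspondence with
the variables in `A`. -/
def IsVTreeFor (T : VTree X) (A : Set X) : Prop := T.leaves.Nodup ∧ T.vars = A

/-- `v.Subtree T`: `v` is a node of `T`, identified with the subtree of `T` rooted at it. -/
def Subtree (v : VTree X) : VTree X → Prop
  | leaf x => v = leaf x
  | node l r => v = node l r ∨ Subtree v l ∨ Subtree v r

/-- At every inner node the left child has at most as many variables as the right child. -/
def Normalized (T : VTree X) : Prop :=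
  ∀ l r : VTree X, (node l r).Subtree T → l.card ≤ r.card

/-- `shell v`: the variables that do not occur below `v`. -/
def shell (v : VTree X) : Set X := {x | x ∉ v.vars}

/-- The modified vtree.  Every inner node `v` with more than two variables gets a new parent,
whose left child is `v` and whose right child is a leaf with a new auxiliary variable.  The
auxiliary variable that belongs to `v` is called `Sum.inr v`. -/
def modified : VTree X → VTree (X ⊕ VTree X)
  | leaf x => leaf (Sum.inl x)
  | node l r =>
      if (node l r).card ≤ 2 then node l.modified r.modified
      else node (node l.modified r.modified) (leaf (Sum.inr (node l r)))

/-- The subtree of the modified vtree rooted at the old node `v`.  (The subtree rooted at the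
new parent of `v`, if there is one, is `v.modified`.) -/
def oldNode : VTree X → VTree (X ⊕ VTree X)
  | leaf x => leaf (Sum.inl x)
  | node l r => node l.modified r.modified

end VTree

/-! ## Circuits in negation normal form -/

/-- Labels of nodes together with the outgoing wires: a Boolean constant, the literal `x`
(`lit x true`) or its negation (`lit x false`), a conjunction with a left and a right child,
a disjunction with a set of children. -/
inductive Gate (X N : Type*) where
  | const (b : Bool) : Gate X N
  | lit (x : X) (b : Bool) : Gate X N
  | and (l r : N) : Gate X N
  | or (cs : Set N) : Gate X N

/-- Renaming variables and nodes. -/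
def Gate.map {X X' N N' : Type*} (f : X → X') (g : N → N') : Gate X N → Gate X' N'
  | const b => const b
  | lit x b => lit (f x) b
  | and l r => and (g l) (g r)
  | or cs => or (g '' cs)

/-- A circuit with variables in `X` and nodes in `N`, without a distinguished output. -/
structure Circuit (X N : Type*) where
  gate : N → Gate X N

namespace Circuit

variable {X N : Type*} (C : Circuit X N)

/-- `C.Child u w`: there is a wire between the gate `u` and its input `w`. -/
def Child (u w : N) : Prop :=
  match C.gate u with
  | .const _ => False
  | .lit _ _ => False
  | .and l r => w = l ∨ w = r
  | .or cs => w ∈ cs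

/-- `w` is a node of the subcircuit rooted at `u`. -/
def Reach (u w : N) : Prop := Relation.ReflTransGen C.Child u w

/-- `vars(u)`: the variables for which a literal appears in the subcircuit rooted at `u`. -/
def vars (u : N) : Set X := {x | ∃ w b, C.Reach u w ∧ C.gate w = .lit x b}

/-- `C.Sat a u`: the subcircuit rooted at `u` evaluates to 1 under the assignment `a`.  Thus
`fun a => C.Sat a u` is the Boolean function represented by the subcircuit rooted at `u`. -/
inductive Sat (a : X → Bool) : N → Prop
  | const {u : N} : C.gate u = .const true → Sat a u
  | lit {u : N} {x : X} {b : Bool} : C.gate u = .lit x b → a x = b → Sat a u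
  | and {u l r : N} : C.gate u = .and l r → Sat a l → Sat a r → Sat a u
  | or {u c : N} {cs : Set N} : C.gate u = .or cs → c ∈ cs → Sat a c → Sat a u

/-- The circuit graph has no directed cycle (and no infinite path). -/
def Acyclic : Prop := WellFounded fun w u => C.Child u w

/-- The children of each conjunction have disjoint sets of variables. -/
def Decomposable : Prop :=
  ∀ u l r, C.gate u = .and l r → Disjoint (C.vars l) (C.vars r)

/-- The functions at the children of each disjunction are disjoint. -/
def Deterministic : Prop :=
  ∀ u cs, C.gate u = .or cs → ∀ c ∈ cs, ∀ d ∈ cs, c ≠ d → ∀ a, ¬ (C.Sat a c ∧ C.Sat a d)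

/-- The conjunction `u` respects the inner node `v` of a vtree. -/
def RespectsNode (u : N) (v : VTree X) : Prop :=
  ∃ l r vl vr, C.gate u = .and l r ∧ v = .node vl vr ∧ C.vars l ⊆ vl.vars ∧ C.vars r ⊆ vr.vars

/-- The circuit respects the vtree `T`: every conjunction respects some node of `T`. -/
def Respects (T : VTree X) : Prop :=
  ∀ u l r, C.gate u = .and l r → ∃ v : VTree X, v.Subtree T ∧ C.RespectsNode u v

/-- All children of a disjunction mention the same variables. -/
def Smooth : Prop :=
  ∀ u cs, C.gate u = .or cs → ∀ c ∈ cs, ∀ d ∈ cs, C.vars c = C.vars d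

/-- There are no edges between disjunctions, no disjunction has a child labeled by a constant,
and only nodes labeled by `⊥` represent the constant function `⊥`. -/
structure Simple : Prop where
  no_or_or : ∀ u cs, C.gate u = .or cs → ∀ c ∈ cs, ∀ ds, C.gate c ≠ .or ds
  no_or_const : ∀ u cs, C.gate u = .or cs → ∀ c ∈ cs, ∀ b, C.gate c ≠ .const b
  bot_only : ∀ u, (∀ a, ¬ C.Sat a u) → C.gate u = .const false

/-- `C.IsDNode T u v`: the node `v` of `T` is the decomposition node of `u`.  For a literal it
is the corresponding leaf, for a conjunction the lowest node of `T` that the conjunction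
respects, and for a disjunction the common decomposition node of the children.  Constants
have no decomposition node. -/
inductive IsDNode (T : VTree X) : N → VTree X → Prop
  | lit {u : N} {x : X} {b : Bool} : C.gate u = .lit x b → (VTree.leaf x).Subtree T →
      IsDNode T u (.leaf x)
  | and {u : N} {v : VTree X} : v.Subtree T → C.RespectsNode u v →
      (∀ v' : VTree X, v'.Subtree v → C.RespectsNode u v' → v' = v) → IsDNode T u v
  | or {u : N} {cs : Set N} {v : VTree X} : C.gate u = .or cs → cs.Nonempty →
      (∀ c ∈ cs, IsDNode T c v) → IsDNode T u v

open Classical in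
/-- The decomposition node of `u` (the root of `T` by convention if there is none, that is,
for constants). -/
noncomputable def dnode (T : VTree X) (u : N) : VTree X :=
  if h : ∃ v, C.IsDNode T u v then h.choose else T

/-- `C.IsSDD T u`: the subcircuit rooted at `u` is a syntactically correct sentential decision
diagram respecting the vtree `T`.  In the third case the output gate is a disjunction of the
conjunctions `g ∈ cs`, where `g` has wires from `prime g` and `sub g`, and the functions at
the `prime g` form a partition. -/
inductive IsSDD : VTree X → N → Prop
  | const {T : VTree X} {u : N} {b : Bool} : C.gate u = .const b → IsSDD T u
  | lit {T : VTree X} {u : N} {x : X} {b : Bool} : C.gate u = .lit x b → x ∈ T.vars →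
      IsSDD T u
  | decomposition {T vl vr : VTree X} {u : N} {cs : Set N} (prime sub : N → N) :
      C.gate u = .or cs →
      (VTree.node vl vr).Subtree T →
      (∀ g ∈ cs, C.gate g = .and (prime g) (sub g)) →
      (∀ g ∈ cs, IsSDD vl (prime g)) →
      (∀ g ∈ cs, IsSDD vr (sub g)) →
      (∀ g ∈ cs, ∃ a, C.Sat a (prime g)) →
      (∀ g ∈ cs, ∀ h ∈ cs, g ≠ h → ∀ a, ¬ (C.Sat a (prime g) ∧ C.Sat a (prime h))) →
      (∀ a, ∃ g ∈ cs, C.Sat a (prime g)) →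
      IsSDD T u

/-- The function at `u` does not become the constant `⊥` when the variables in `A` are
replaced according to `p`. -/
def SatUnder (A : Set X) (p : X → Bool) (u : N) : Prop :=
  ∃ a : X → Bool, (∀ x ∈ A, a x = p x) ∧ C.Sat a u

end Circuit

/-- A circuit with a distinguished root (output gate). -/
structure NNF (X N : Type*) extends Circuit X N where
  root : N

namespace NNF

variable {X N : Type*} (D : NNF X N)

/-- The circuit represents the Boolean function `f`. -/
def Represents (f : (X → Bool) → Bool) : Prop :=
  ∀ a, D.Sat a D.root ↔ f a = true

/-- `D` is a structured d-DNNF with respect to `T`. -/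
structure IsStructuredDDNNF (T : VTree X) : Prop where
  acyclic : D.Acyclic
  decomposable : D.Decomposable
  deterministic : D.Deterministic
  respects : D.Respects T

/-- Conventions on the circuits: every node is connected to the root; constants do not feed
into conjunctions; and the circuit mentions all variables unless it is a single constant. -/
structure Proper : Prop where
  connected : ∀ u, D.Reach D.root u
  no_and_const : ∀ u l r, D.gate u = .and l r →
    ∀ b, D.gate l ≠ .const b ∧ D.gate r ≠ .const b
  mentions_all : (∃ b, D.gate D.root = .const b) ∨ D.vars D.root = Set.univ

/-- `D.InRestriction A p u`: the gate `u` is a node of the circuit obtained from `D` by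
replacing the variables in `A` according to `p`, eliminating everything that computes `⊥`, and
removing all nodes that are no longer connected to the root.  (Only the values of `p` on `A`
matter.  Gates all of whose variables are in `A` and that become `⊤` are kept here; they have no
variable outside `A`, hence never occur in the sets `R` below.) -/
inductive InRestriction (A : Set X) (p : X → Bool) : N → Prop
  | root : D.SatUnder A p D.root → InRestriction A p D.root
  | child {u w : N} : InRestriction A p u → D.Child u w → D.SatUnder A p w →
      InRestriction A p w

/-- `R(D_p, v)` for a shell restriction `p` with respect to the node `v`: the nodes of `D_p`
with decomposition node `v`.  (Only the values of `p` on `shell v` matter.) -/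
def R (T : VTree X) (p : X → Bool) (v : VTree X) : Set N :=
  {u | D.InRestriction v.shell p u ∧ D.IsDNode T u v}

/-- `R⁺(D_p, v)`: the nodes in `R(D_p, v)` without a child in `R(D_p, v)`. -/
def RPlus (T : VTree X) (p : X → Bool) (v : VTree X) : Set N :=
  {u | u ∈ D.R T p v ∧ ∀ w, D.Child u w → w ∉ D.R T p v}

/-- Removing all nodes that cannot be reached from the root. -/
def trim : NNF X {u : N // D.Reach D.root u} where
  gate u :=
    match h : D.gate u.1 with
    | .const b => .const b
    | .lit x b => .lit x b
    | .and l r =>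
        .and ⟨l, u.2.tail (by simp [Circuit.Child, h])⟩ ⟨r, u.2.tail (by simp [Circuit.Child, h])⟩
    | .or cs => .or {c | c.1 ∈ cs}
  root := ⟨D.root, Relation.ReflTransGen.refl⟩

end NNF

/-! ## The simulation

`D` and `Dc` are the given circuits for a function and its complement, with node sets `V` and
`W`.  The set `Y` of all their nodes is the disjoint union `V ⊕ W`. -/

section Simulation

variable {X V W : Type*}

/-- The disjoint union of the circuits. -/
def both (D : NNF X V) (Dc : NNF X W) : Circuit X (V ⊕ W) where
  gate := Sum.elim (fun u => (D.gate u).map id Sum.inl) (fun w => (Dc.gate w).map id Sum.inr)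

/-- The function represented at `u` in the circuit that `u` belongs to. -/
def origSat (D : NNF X V) (Dc : NNF X W) (a : X → Bool) : V ⊕ W → Prop :=
  Sum.elim (D.Sat a) (Dc.Sat a)

/-- The decomposition node of `u` in the circuit that `u` belongs to. -/
noncomputable def dnodeY (D : NNF X V) (Dc : NNF X W) (T : VTree X) : V ⊕ W → VTree X :=
  Sum.elim (D.dnode T) (Dc.dnode T)

/-- `R(D_p, v) ∪ R(Dc_p, v)`. -/
def RY (D : NNF X V) (Dc : NNF X W) (T : VTree X) (p : X → Bool) (v : VTree X) : Set (V ⊕ W) :=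
  Sum.inl '' D.R T p v ∪ Sum.inr '' Dc.R T p v

/-- `R⁺(D_p, v) ∪ R⁺(Dc_p, v)`. -/
def RPlusY (D : NNF X V) (Dc : NNF X W) (T : VTree X) (p : X → Bool) (v : VTree X) :
    Set (V ⊕ W) :=
  Sum.inl '' D.RPlus T p v ∪ Sum.inr '' Dc.RPlus T p v

/-- The choices made in the simulation.

* For a disjunction `u` with decomposition node `v` a shell restriction `p u` with respect to `v`
  such that `u` lies in `R(D_p, v)` (or `R(Dc_p, v)`, for the circuit that contains `u`).
* For a conjunction `u` with left child `l`, whose decomposition node is `v`, a shell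
  restriction `p u` with respect to `v` such that `l` lies in `R(D_p, v)` (or `R(Dc_p, v)`).
* For every node `u` whose decomposition node `v` has at most two variables, an SDD for the
  function represented at `u` that respects the subtree rooted at `v`; it is the subcircuit
  rooted at `blockRoot u` of the finite circuit `block`. -/
structure SimulationData (D : NNF X V) (Dc : NNF X W) (T : VTree X) where
  p : V ⊕ W → X → Bool
  p_or : ∀ u cs, (both D Dc).gate u = .or cs → 2 < (dnodeY D Dc T u).card →
    u ∈ RY D Dc T (p u) (dnodeY D Dc T u)
  p_and : ∀ u l r, (both D Dc).gate u = .and l r → 2 < (dnodeY D Dc T u).card →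
    l ∈ RY D Dc T (p u) (dnodeY D Dc T l)
  BlockNode : Type
  finite_block : Finite BlockNode
  block : Circuit X BlockNode
  blockRoot : V ⊕ W → BlockNode
  block_sdd : ∀ u, (dnodeY D Dc T u).card ≤ 2 → block.IsSDD (dnodeY D Dc T u) (blockRoot u)
  block_fun : ∀ u, (dnodeY D Dc T u).card ≤ 2 →
    ∀ a, block.Sat a (blockRoot u) ↔ origSat D Dc a u

/-- The nodes of the constructed circuit: `main u` is `(u, ∅)`, `wedge u` is `(u, ∧)`,
`top u` is `(u, ⊤)`, `bot u` is `(u, ⊥)`, `pair u w` is `(u, w)` for a node `w`, and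
`block n` are the nodes of the SDDs on at most two variables. -/
inductive SimNode (Y B : Type*) where
  | main (u : Y) : SimNode Y B
  | wedge (u : Y) : SimNode Y B
  | top (u : Y) : SimNode Y B
  | bot (u : Y) : SimNode Y B
  | pair (u w : Y) : SimNode Y B
  | block (n : B) : SimNode Y B

instance {Y B : Type*} [Finite Y] [Finite B] : Finite (SimNode Y B) := by
  let g : (Y ⊕ Y ⊕ Y ⊕ Y ⊕ (Y × Y) ⊕ B) → SimNode Y B :=
    Sum.elim .main <| Sum.elim .wedge <| Sum.elim .top <| Sum.elim .bot <|
      Sum.elim (fun q => .pair q.1 q.2) .block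
  refine Finite.of_surjective g ?_
  rintro (u | u | u | u | ⟨u, w⟩ | n)
  · exact ⟨.inl u, rfl⟩
  · exact ⟨.inr (.inl u), rfl⟩
  · exact ⟨.inr (.inr (.inl u)), rfl⟩
  · exact ⟨.inr (.inr (.inr (.inl u))), rfl⟩
  · exact ⟨.inr (.inr (.inr (.inr (.inl (u, w))))), rfl⟩
  · exact ⟨.inr (.inr (.inr (.inr (.inr n)))), rfl⟩

open Classical in
/-- The constructed circuit before the removal of unreachable nodes.  Tuples that the
construction does not use get the dummy label `⊥`; no node `(u, ∅)` leads to them. -/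
noncomputable def simulationGraph {D : NNF X V} {Dc : NNF X W} {T : VTree X}
    (s : SimulationData D Dc T) : NNF (X ⊕ VTree X) (SimNode (V ⊕ W) s.BlockNode) where
  gate
    | .main u =>
        match (both D Dc).gate u with
        | .const b => .const b
        | .lit x b => .lit (Sum.inl x) b
        | .and l _ =>
            if (dnodeY D Dc T u).card ≤ 2 then
              (s.block.gate (s.blockRoot u)).map Sum.inl .block
            else
              .or (insert (.wedge u)
                (.pair u '' {w | w ∈ RPlusY D Dc T (s.p u) (dnodeY D Dc T l) ∧ w ≠ l ∧
                  ¬ (both D Dc).Child l w}))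
        | .or _ =>
            if (dnodeY D Dc T u).card ≤ 2 then
              (s.block.gate (s.blockRoot u)).map Sum.inl .block
            else
              .or (.pair u '' RPlusY D Dc T (s.p u) (dnodeY D Dc T u))
    | .wedge u =>
        match (both D Dc).gate u with
        | .and l r => .and (.main l) (.main r)
        | _ => .const false
    | .top _ => .const true
    | .bot _ => .const false
    | .pair u w =>
        match (both D Dc).gate u with
        | .or cs => .and (.main w) (if w ∈ cs then .top u else .bot u)
        | .and _ _ => .and (.main w) (.bot u)
        | _ => .const false
    | .block n => (s.block.gate n).map Sum.inl .block
  root := .main (Sum.inl D.root)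

/-- The result `S` of the simulation. -/
noncomputable def simulation {D : NNF X V} {Dc : NNF X W} {T : VTree X}
    (s : SimulationData D Dc T) :
    NNF (X ⊕ VTree X)
      {n : SimNode (V ⊕ W) s.BlockNode //
        (simulationGraph s).Reach (simulationGraph s).root n} :=
  (simulationGraph s).trim

open Classical in
/-- The subtree of the modified vtree rooted at `node(u)`: `node(u)` is the old node `v`, the
decomposition node of `u`, if `u` is a conjunction or `v` has at most two variables, and the
new parent of `v` otherwise. -/
noncomputable def nodeTree (D : NNF X V) (Dc : NNF X W) (T : VTree X) (u : V ⊕ W) :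
    VTree (X ⊕ VTree X) :=
  if (∃ l r, (both D Dc).gate u = .and l r) ∨ (dnodeY D Dc T u).card ≤ 2 then
    (dnodeY D Dc T u).oldNode
  else (dnodeY D Dc T u).modified

end Simulation

end SDDSim

open SDDSim

namespace SDDSim

/-! ### Nodes of a vtree and their variable sets -/

namespace VTree

variable {X : Type*}

/-! The primes at each gate of `S` must form a partition, and the complement circuit supplies the
missing part. Smoothness, together with the root mentioning all variables, forces every nonconstant
gate `u` to mention exactly `vars(v)` for one node `v` of `T`. Thus "decomposition node `v`" simply
means "variable set `vars(v)`" (`NNF.Regular.isDNode_iff`), a wire leaving an ∧-gate strictly lowers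
the decomposition node, and a wire leaving an ∨-gate preserves it. In particular `R⁺` consists of
the gates in `R` that are not disjunctions (`NNF.Regular.mem_RPlus_iff`).

Fix an assignment `a` satisfying the root of a circuit. Following satisfied gates downwards, one
meets exactly one gate other than a disjunction at each node `v`: existence is
`NNF.Regular.exists_satPath`; uniqueness, `NNF.Regular.satPath_unique`, comes from decomposability
and determinism. Conversely, if `a` agrees with `p` on `shell(v)`, each gate of `R(D_p, v)`
satisfied by `a` lies on a satisfied path from a satisfied root
(`NNF.Regular.satPath_of_inRestriction`). Every assignment satisfies exactly one of the two roots.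
Hence exactly one function in `R⁺(D_p, v) ∪ R⁺(Dc_p, v)` is true at any given assignment
(`ComplementaryPair.RPlusY_cover`, `ComplementaryPair.RPlusY_disjoint`).

For an ∨-gate `u` the primes are this whole partition, and the subs ⊤ and ⊥ select the children of
`u`. For an ∧-gate the function at the left child is one block, and the remaining elements of the
partition complete it with sub ⊥. Correctness follows by induction on the vtree node, with ∧-gates
at `v` before ∨-gates at `v` (`correct_and`, `correct_or`). The new parent in `T'` gives the ∨-gate
a place above ∧-gates with the same variables. -/

theorem Subtree.refl (v : VTree X) : v.Subtree v := by
  cases v <;> simp [Subtree]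

theorem Subtree.trans {u v w : VTree X} (huv : u.Subtree v) (hvw : v.Subtree w) :
    u.Subtree w := by
  induction w with
  | leaf x => obtain rfl : v = leaf x := hvw; exact huv
  | node l r ihl ihr =>
    rcases hvw with rfl | h | h
    · exact huv
    · exact .inr (.inl (ihl h))
    · exact .inr (.inr (ihr h))

theorem subtree_node_left (l r : VTree X) : l.Subtree (node l r) := .inr (.inl (.refl l))

theorem subtree_node_right (l r : VTree X) : r.Subtree (node l r) := .inr (.inr (.refl r))

theorem Subtree.sublist {v T : VTree X} (h : v.Subtree T) : v.leaves.Sublist T.leaves := by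
  induction T with
  | leaf x => obtain rfl : v = leaf x := h; exact List.Sublist.refl _
  | node l r ihl ihr =>
    rcases h with rfl | h | h
    · exact List.Sublist.refl _
    · exact (ihl h).trans (List.sublist_append_left _ _)
    · exact (ihr h).trans (List.sublist_append_right _ _)

theorem Subtree.vars_subset {v T : VTree X} (h : v.Subtree T) : v.vars ⊆ T.vars :=
  fun _ hx => h.sublist.subset hx

theorem Subtree.card_le {v T : VTree X} (h : v.Subtree T) : v.card ≤ T.card :=
  h.sublist.length_le

theorem Subtree.nodup {v T : VTree X} (h : v.Subtree T) (hT : T.leaves.Nodup) :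
    v.leaves.Nodup :=
  hT.sublist h.sublist

theorem vars_nonempty (v : VTree X) : v.vars.Nonempty := by
  induction v with
  | leaf x => exact ⟨x, by simp [vars, leaves]⟩
  | node l r ihl _ =>
    obtain ⟨x, hx⟩ := ihl
    exact ⟨x, List.mem_append_left _ hx⟩

theorem card_pos (v : VTree X) : 0 < v.card := by
  obtain ⟨x, hx⟩ := v.vars_nonempty
  exact List.length_pos_of_mem hx

theorem card_node (l r : VTree X) : (node l r).card = l.card + r.card := by
  simp [card, leaves]

@[simp] theorem vars_leaf (x : X) : (leaf x).vars = {x} := by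
  ext; simp [vars, leaves]

theorem vars_node (l r : VTree X) : (node l r).vars = l.vars ∪ r.vars := by
  ext; simp [vars, leaves]

theorem disjoint_vars {l r : VTree X} (h : (node l r).leaves.Nodup) :
    Disjoint l.vars r.vars := by
  rw [Set.disjoint_left]
  intro x hl hr
  exact (List.nodup_append'.1 h).2.2 hl hr

/-- Both nodes lie on the unique path from the root to the leaf `x`. -/
theorem Subtree.comparable {T v w : VTree X} (hT : T.leaves.Nodup) (hv : v.Subtree T)
    (hw : w.Subtree T) {x : X} (hxv : x ∈ v.vars) (hxw : x ∈ w.vars) :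
    v.Subtree w ∨ w.Subtree v := by
  induction T with
  | leaf y =>
    obtain rfl : v = leaf y := hv
    exact .inr hw
  | node l r ihl ihr =>
    have hd := Set.disjoint_left.1 (disjoint_vars hT)
    rcases hv with rfl | hv | hv
    · exact .inr hw
    · rcases hw with rfl | hw | hw
      · exact .inl (.inr (.inl hv))
      · exact ihl ((subtree_node_left l r).nodup hT) hv hw
      · exact absurd (hw.vars_subset hxw) (hd (hv.vars_subset hxv))
    · rcases hw with rfl | hw | hw
      · exact .inl (.inr (.inr hv))
      · exact absurd (hv.vars_subset hxv) (hd (hw.vars_subset hxw))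
      · exact ihr ((subtree_node_right l r).nodup hT) hv hw

/-- A proper subtree misses all variables of the sibling branch. -/
theorem Subtree.eq_of_vars_subset {v w : VTree X} (hw : w.leaves.Nodup) (h : v.Subtree w)
    (hs : w.vars ⊆ v.vars) : v = w := by
  cases w with
  | leaf y => exact h
  | node l r =>
    have hd := Set.disjoint_left.1 (disjoint_vars hw)
    rw [vars_node] at hs
    rcases h with h | h | h
    · exact h
    · obtain ⟨x, hx⟩ := r.vars_nonempty
      exact absurd hx (hd (h.vars_subset (hs (.inr hx))))
    · obtain ⟨x, hx⟩ := l.vars_nonempty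
      exact absurd (h.vars_subset (hs (.inl hx))) (hd hx)

theorem Subtree.eq_of_vars_eq {T v w : VTree X} (hT : T.leaves.Nodup) (hv : v.Subtree T)
    (hw : w.Subtree T) (h : v.vars = w.vars) : v = w := by
  obtain ⟨x, hx⟩ := v.vars_nonempty
  rcases hv.comparable hT hw hx (h ▸ hx) with hc | hc
  · exact hc.eq_of_vars_subset (hw.nodup hT) h.ge
  · exact (hc.eq_of_vars_subset (hv.nodup hT) h.le).symm

theorem eq_leaf_of_vars {v : VTree X} (hv : v.leaves.Nodup) {x : X} (h : v.vars = {x}) :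
    v = leaf x := by
  cases v with
  | leaf y => rw [vars_leaf, Set.singleton_eq_singleton_iff] at h; rw [h]
  | node l r =>
    rw [vars_node] at h
    obtain ⟨y, hy⟩ := l.vars_nonempty
    obtain ⟨z, hz⟩ := r.vars_nonempty
    have hyx : y = x := h.subset (.inl hy)
    have hzx : z = x := h.subset (.inr hz)
    exact absurd hz (hzx ▸ hyx ▸ Set.disjoint_left.1 (disjoint_vars hv) hy)

/-! ### The modified vtree -/

theorem modified_of_card_le {v : VTree X} (h : v.card ≤ 2) : v.modified = v.oldNode := by
  cases v <;> simp [modified, oldNode, h]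

theorem modified_of_two_lt {v : VTree X} (h : 2 < v.card) :
    v.modified = node v.oldNode (leaf (Sum.inr v)) := by
  cases v with
  | leaf x => simp [card, leaves] at h
  | node l r => simp [modified, oldNode, h]

theorem oldNode_subtree_modified (v : VTree X) : v.oldNode.Subtree v.modified := by
  by_cases h : v.card ≤ 2
  · rw [modified_of_card_le h]; exact .refl _
  · rw [modified_of_two_lt (not_le.1 h)]; exact subtree_node_left _ _

theorem Subtree.modified {v T : VTree X} (h : v.Subtree T) : v.modified.Subtree T.modified := by
  induction T with
  | leaf x => obtain rfl : v = leaf x := h; exact .refl _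
  | node l r ihl ihr =>
    rcases h with rfl | h | h
    · exact .refl _
    · exact ((ihl h).trans (subtree_node_left _ _)).trans (oldNode_subtree_modified (node l r))
    · exact ((ihr h).trans (subtree_node_right _ _)).trans (oldNode_subtree_modified (node l r))

theorem leaves_modified_node (l r : VTree X) : (node l r).modified.leaves =
    l.modified.leaves ++ r.modified.leaves ++
      if (node l r).card ≤ 2 then [] else [Sum.inr (node l r)] := by
  by_cases h : (node l r).card ≤ 2
  · simp [modified, h, leaves]
  · simp [modified, h, leaves]

theorem inl_mem_leaves_modified {v : VTree X} {x : X} :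
    Sum.inl x ∈ v.modified.leaves ↔ x ∈ v.leaves := by
  induction v with
  | leaf y => simp [modified, leaves]
  | node l r ihl ihr =>
    rw [leaves_modified_node, List.mem_append, List.mem_append, ihl, ihr, leaves,
      List.mem_append]
    split_ifs <;> simp

theorem inr_mem_leaves_modified {v w : VTree X} :
    Sum.inr w ∈ v.modified.leaves ↔ w.Subtree v ∧ 2 < w.card := by
  induction v with
  | leaf y =>
    simp only [modified, leaves, List.mem_singleton, reduceCtorEq, false_iff, not_and]
    intro h
    obtain rfl : w = leaf y := h
    simp [card, leaves]
  | node l r ihl ihr =>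
    rw [leaves_modified_node, List.mem_append, List.mem_append, ihl, ihr, Subtree]
    split_ifs with h
    · simp only [List.not_mem_nil, or_false]
      constructor
      · tauto
      · rintro ⟨rfl | h' | h', hc⟩
        · omega
        · exact .inl ⟨h', hc⟩
        · exact .inr ⟨h', hc⟩
    · simp only [List.mem_singleton, Sum.inr.injEq]
      constructor
      · rintro ((h' | h') | rfl)
        · exact ⟨.inr (.inl h'.1), h'.2⟩
        · exact ⟨.inr (.inr h'.1), h'.2⟩
        · exact ⟨.inl rfl, not_le.1 h⟩
      · tauto

theorem nodup_leaves_modified {v : VTree X} (hv : v.leaves.Nodup) :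
    v.modified.leaves.Nodup := by
  induction v with
  | leaf y => simp [modified, leaves]
  | node l r ihl ihr =>
    have hd := Set.disjoint_left.1 (disjoint_vars hv)
    have hl := ihl ((subtree_node_left l r).nodup hv)
    have hr := ihr ((subtree_node_right l r).nodup hv)
    rw [leaves_modified_node, List.nodup_append', List.nodup_append']
    refine ⟨⟨hl, hr, ?_⟩, by split_ifs <;> simp, ?_⟩
    · rintro (x | w) h1 h2
      · exact hd (inl_mem_leaves_modified.1 h1) (inl_mem_leaves_modified.1 h2)
      -- An auxiliary variable occurring on both sides would make `w` a node of both children, which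
      -- share no variable.
      · obtain ⟨x, hx⟩ := w.vars_nonempty
        exact hd ((inr_mem_leaves_modified.1 h1).1.vars_subset hx)
          ((inr_mem_leaves_modified.1 h2).1.vars_subset hx)
    · intro y h1 h2
      split_ifs at h2
      · simp at h2
      · rw [List.mem_singleton] at h2
        subst h2
        -- The new leaf is named after the whole tree, which has too many leaves to be a node of
        -- either child.
        have hl := l.card_pos
        have hr := r.card_pos
        rcases List.mem_append.1 h1 with h | h
        · have := (inr_mem_leaves_modified.1 h).1.card_le
          rw [card_node] at this; omega
        · have := (inr_mem_leaves_modified.1 h).1.card_le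
          rw [card_node] at this; omega

theorem IsVTreeFor.modified {T : VTree X} (hT : T.IsVTreeFor Set.univ) :
    T.modified.IsVTreeFor
      (Set.range Sum.inl ∪ Sum.inr '' {v : VTree X | v.Subtree T ∧ 2 < v.card}) := by
  refine ⟨nodup_leaves_modified hT.1, ?_⟩
  ext (x | w)
  · have hx : x ∈ T.vars := hT.2 ▸ Set.mem_univ x
    simpa [vars, inl_mem_leaves_modified] using hx
  · simp [vars, inr_mem_leaves_modified]

end VTree

/-! ## General facts about circuits -/

namespace Circuit

variable {X N : Type*} {C : Circuit X N}

theorem child_of_and_left {u l r : N} (h : C.gate u = .and l r) : C.Child u l := by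
  simp [Child, h]

theorem child_of_and_right {u l r : N} (h : C.gate u = .and l r) : C.Child u r := by
  simp [Child, h]

theorem child_of_or {u c : N} {cs : Set N} (h : C.gate u = .or cs) (hc : c ∈ cs) :
    C.Child u c := by
  simpa [Child, h] using hc

theorem child_cases {u w : N} (h : C.Child u w) :
    (∃ l r, C.gate u = .and l r ∧ (w = l ∨ w = r)) ∨ ∃ cs, C.gate u = .or cs ∧ w ∈ cs := by
  unfold Child at h
  split at h
  · exact h.elim
  · exact h.elim
  · exact .inl ⟨_, _, by assumption, h⟩
  · exact .inr ⟨_, by assumption, h⟩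

theorem sat_const {a : X → Bool} {u : N} {b : Bool} (h : C.gate u = .const b) :
    C.Sat a u ↔ b = true := by
  constructor
  · intro hs; cases hs <;> simp_all
  · rintro rfl; exact .const h

theorem sat_lit {a : X → Bool} {u : N} {x : X} {b : Bool} (h : C.gate u = .lit x b) :
    C.Sat a u ↔ a x = b := by
  constructor
  · intro hs; cases hs <;> simp_all
  · exact .lit h

theorem sat_and {a : X → Bool} {u l r : N} (h : C.gate u = .and l r) :
    C.Sat a u ↔ C.Sat a l ∧ C.Sat a r := by
  constructor
  · intro hs; cases hs <;> simp_all
  · exact fun hs => .and h hs.1 hs.2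

theorem sat_or {a : X → Bool} {u : N} {cs : Set N} (h : C.gate u = .or cs) :
    C.Sat a u ↔ ∃ c ∈ cs, C.Sat a c := by
  constructor
  · intro hs
    cases hs with
    | or h' hc hs => rw [h] at h'; cases h'; exact ⟨_, hc, hs⟩
    | _ => simp_all
  · rintro ⟨c, hc, hs⟩; exact .or h hc hs

theorem vars_subset_of_reach {u w : N} (h : C.Reach u w) : C.vars w ⊆ C.vars u := by
  rintro x ⟨n, b, hn, hg⟩
  exact ⟨n, b, h.trans hn, hg⟩

theorem vars_subset_of_child {u w : N} (h : C.Child u w) : C.vars w ⊆ C.vars u :=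
  vars_subset_of_reach (.single h)

theorem mem_vars_iff {u : N} {x : X} :
    x ∈ C.vars u ↔ (∃ b, C.gate u = .lit x b) ∨ ∃ w, C.Child u w ∧ x ∈ C.vars w := by
  constructor
  · rintro ⟨n, b, hn, hg⟩
    rcases hn.cases_head with rfl | ⟨w, hw, hwn⟩
    · exact .inl ⟨b, hg⟩
    · exact .inr ⟨w, hw, n, b, hwn, hg⟩
  · rintro (⟨b, hg⟩ | ⟨w, hw, hx⟩)
    · exact ⟨u, b, .refl, hg⟩
    · exact vars_subset_of_child hw hx

theorem vars_const {u : N} {b : Bool} (h : C.gate u = .const b) : C.vars u = ∅ := by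
  ext x; rw [mem_vars_iff]; simp [Child, h]

theorem vars_lit {u : N} {x : X} {b : Bool} (h : C.gate u = .lit x b) : C.vars u = {x} := by
  ext y; rw [mem_vars_iff]; simp [Child, h, eq_comm]

theorem vars_and {u l r : N} (h : C.gate u = .and l r) : C.vars u = C.vars l ∪ C.vars r := by
  ext y; rw [mem_vars_iff]; simp [Child, h]

theorem vars_or {u : N} {cs : Set N} (h : C.gate u = .or cs) :
    C.vars u = ⋃ c ∈ cs, C.vars c := by
  ext y; rw [mem_vars_iff]; simp [Child, h]

theorem Sat.congr {a b : X → Bool} {u : N} (hs : C.Sat a u) (h : ∀ x ∈ C.vars u, a x = b x) :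
    C.Sat b u := by
  induction hs with
  | const hg => exact .const hg
  | lit hg ha => exact .lit hg (by rw [← h _ (by simp [vars_lit hg]), ha])
  | and hg _ _ ihl ihr =>
    rw [vars_and hg] at h
    exact .and hg (ihl fun x hx => h x (.inl hx)) (ihr fun x hx => h x (.inr hx))
  | or hg hc _ ih =>
    exact .or hg hc (ih fun x hx => h x (vars_subset_of_child (child_of_or hg hc) hx))

theorem sat_congr {a b : X → Bool} {u : N} (h : ∀ x ∈ C.vars u, a x = b x) :
    C.Sat a u ↔ C.Sat b u :=
  ⟨fun hs => hs.congr h, fun hs => hs.congr fun x hx => (h x hx).symm⟩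

/-- No induction is needed: the primes and subs are tied to the children of the chosen inner node,
not to `T`. -/
theorem IsSDD.mono {T T' : VTree X} {u : N} (h : C.IsSDD T u) (hT : T.Subtree T') :
    C.IsSDD T' u := by
  cases h with
  | const hg => exact .const hg
  | lit hg hx => exact .lit hg (hT.vars_subset hx)
  | decomposition prime sub hg hv h1 h2 h3 h4 h5 h6 =>
    exact .decomposition prime sub hg (hv.trans hT) h1 h2 h3 h4 h5 h6

theorem sat_of_gate_eq {a : X → Bool} {u w : N} (h : C.gate u = C.gate w) (hs : C.Sat a u) :
    C.Sat a w := by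
  cases hs with
  | const hg => exact .const (h ▸ hg)
  | lit hg ha => exact .lit (h ▸ hg) ha
  | and hg hl hr => exact .and (h ▸ hg) hl hr
  | or hg hc hs => exact .or (h ▸ hg) hc hs

/-- Needed because a node `(u, ∅)` on at most two variables copies the label of its block root
instead of being that root. -/
theorem IsSDD.of_gate_eq {T : VTree X} {u w : N} (h : C.gate u = C.gate w)
    (hs : C.IsSDD T u) : C.IsSDD T w := by
  cases hs with
  | const hg => exact .const (h ▸ hg)
  | lit hg hx => exact .lit (h ▸ hg) hx
  | decomposition prime sub hg hv h1 h2 h3 h4 h5 h6 =>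
    exact .decomposition prime sub (h ▸ hg) hv h1 h2 h3 h4 h5 h6

/-! ### Satisfied paths -/

/-- Paths all of whose nodes after the first one are satisfied. -/
def SatPath (C : Circuit X N) (a : X → Bool) : N → N → Prop :=
  Relation.ReflTransGen fun u w => C.Child u w ∧ C.Sat a w

theorem SatPath.reach {a : X → Bool} {u w : N}
    (h : C.SatPath a u w) : C.Reach u w :=
  Relation.ReflTransGen.mono (fun _ _ h => h.1) _ _ h

theorem SatPath.congr {a b : X → Bool} {u w : N}
    (h : C.SatPath a u w) (hab : ∀ x ∈ C.vars u, a x = b x) : C.SatPath b u w := by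
  induction h using Relation.ReflTransGen.head_induction_on with
  | refl => exact .refl
  | head hc _ ih =>
    have hs := vars_subset_of_child hc.1
    exact .head ⟨hc.1, hc.2.congr fun x hx => hab x (hs hx)⟩ (ih fun x hx => hab x (hs hx))

/-! ### Maps between circuits -/

section Map

variable {X' N' : Type*} {C' : Circuit X' N'} {ι : X → X'} {φ : N → N'}

theorem Sat.map {a : X' → Bool} {u : N} (hφ : ∀ n, C'.gate (φ n) = (C.gate n).map ι φ)
    (h : C.Sat (a ∘ ι) u) : C'.Sat a (φ u) := by
  induction h with
  | @const u hg => exact .const (by rw [hφ, hg]; rfl)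
  | @lit u x b hg ha => exact .lit (x := ι x) (b := b) (by rw [hφ, hg]; rfl) ha
  | @and u l r hg _ _ ihl ihr => exact .and (l := φ l) (r := φ r) (by rw [hφ, hg]; rfl) ihl ihr
  | @or u c cs hg hc _ ih =>
    exact .or (cs := φ '' cs) (by rw [hφ, hg]; rfl) (Set.mem_image_of_mem φ hc) ih

theorem Sat.of_map {a : X' → Bool} {u : N} (hφ : ∀ n, C'.gate (φ n) = (C.gate n).map ι φ)
    (h : C'.Sat a (φ u)) : C.Sat (a ∘ ι) u := by
  generalize hn : φ u = n at h
  induction h generalizing u with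
  | const hg =>
    subst hn; rw [hφ] at hg
    cases hu : C.gate u <;> simp only [hu, Gate.map] at hg <;> cases hg
    exact .const hu
  | lit hg ha =>
    subst hn; rw [hφ] at hg
    cases hu : C.gate u <;> simp only [hu, Gate.map] at hg <;> cases hg
    exact .lit hu ha
  | and hg _ _ ihl ihr =>
    subst hn; rw [hφ] at hg
    cases hu : C.gate u <;> simp only [hu, Gate.map] at hg <;> cases hg
    exact .and hu (ihl rfl) (ihr rfl)
  | or hg hc _ ih =>
    subst hn; rw [hφ] at hg
    cases hu : C.gate u <;> simp only [hu, Gate.map] at hg <;> cases hg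
    obtain ⟨d, hd, rfl⟩ := hc
    exact .or hu hd (ih rfl)

/-- A map compatible with labels preserves the subcircuit below each node. This covers the
embeddings into the disjoint union, the inclusion of the blocks, and trimming. -/
theorem sat_map_iff {a : X' → Bool} {u : N} (hφ : ∀ n, C'.gate (φ n) = (C.gate n).map ι φ) :
    C'.Sat a (φ u) ↔ C.Sat (a ∘ ι) u :=
  ⟨.of_map hφ, .map hφ⟩

end Map

end Circuit

/-- Renaming the variables of a vtree. -/
def VTree.map {X X' : Type*} (ι : X → X') : VTree X → VTree X'
  | leaf x => leaf (ι x)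
  | node l r => node (l.map ι) (r.map ι)

namespace VTree

variable {X X' : Type*} {ι : X → X'}

theorem leaves_map (v : VTree X) : (v.map ι).leaves = v.leaves.map ι := by
  induction v with
  | leaf x => rfl
  | node l r ihl ihr => simp [map, leaves, ihl, ihr]

theorem Subtree.map {v T : VTree X} (h : v.Subtree T) : (v.map ι).Subtree (T.map ι) := by
  induction T with
  | leaf x => obtain rfl : v = leaf x := h; exact .refl _
  | node l r ihl ihr =>
    rcases h with rfl | h | h
    · exact .refl _
    · exact .inr (.inl (ihl h))
    · exact .inr (.inr (ihr h))

theorem map_id (v : VTree X) : v.map id = v := by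
  induction v with
  | leaf x => rfl
  | node l r ihl ihr => rw [map, ihl, ihr]

/-- No auxiliary leaf is inserted this low, so the block SDDs carry over by mere renaming. -/
theorem modified_eq_map {v : VTree X} (h : v.card ≤ 2) : v.modified = v.map Sum.inl := by
  induction v with
  | leaf x => rfl
  | node l r ihl ihr =>
    have h' := h
    rw [card_node] at h'
    rw [modified, if_pos h, ihl (by omega), ihr (by omega), map]

end VTree

/-! ### Transporting SDDs along maps of circuits -/

namespace Circuit

variable {X N X' N' : Type*} {C : Circuit X N} {C' : Circuit X' N'} {ι : X → X'} {φ : N → N'}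

/-- Families that are given on the conjunctions by the left and the right wires. -/
theorem exists_wires (C : Circuit X N) : ∃ prime sub : N → N,
    ∀ g l r, C.gate g = .and l r → prime g = l ∧ sub g = r := by
  refine ⟨fun g => match C.gate g with | .and l _ => l | _ => g,
    fun g => match C.gate g with | .and _ r => r | _ => g, ?_⟩
  intro g l r h
  simp [h]

/-- The decomposition rule for SDDs, with the primes and subs in relational form. -/
theorem IsSDD.of_decomposition {T vl vr : VTree X} {u : N} {cs : Set N}
    (hg : C.gate u = .or cs) (hv : (VTree.node vl vr).Subtree T)
    (hand : ∀ g ∈ cs, ∃ l r, C.gate g = .and l r ∧ C.IsSDD vl l ∧ C.IsSDD vr r ∧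
      ∃ a, C.Sat a l)
    (hdisj : ∀ g ∈ cs, ∀ h ∈ cs, ∀ l r l' r' a, C.gate g = .and l r → C.gate h = .and l' r' →
      C.Sat a l → C.Sat a l' → g = h)
    (hcover : ∀ a, ∃ g ∈ cs, ∃ l r, C.gate g = .and l r ∧ C.Sat a l) :
    C.IsSDD T u := by
  obtain ⟨prime, sub, hw⟩ := C.exists_wires
  have hand' : ∀ g ∈ cs, C.gate g = .and (prime g) (sub g) ∧ C.IsSDD vl (prime g) ∧
      C.IsSDD vr (sub g) ∧ ∃ a, C.Sat a (prime g) := by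
    intro g hgc
    obtain ⟨l, r, hlr, h⟩ := hand g hgc
    obtain ⟨h1, h2⟩ := hw g l r hlr
    rw [h1, h2]
    exact ⟨hlr, h⟩
  refine .decomposition prime sub hg hv (fun g h => (hand' g h).1) (fun g h => (hand' g h).2.1)
    (fun g h => (hand' g h).2.2.1) (fun g h => (hand' g h).2.2.2) ?_ ?_
  · intro g hgc h hhc hne a ha
    exact hne (hdisj g hgc h hhc _ _ _ _ a (hand' g hgc).1 (hand' h hhc).1 ha.1 ha.2)
  · intro a
    obtain ⟨g, hgc, l, r, hlr, hs⟩ := hcover a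
    exact ⟨g, hgc, (hw g l r hlr).1 ▸ hs⟩

theorem IsSDD.map (hι : Function.Injective ι)
    (hφ : ∀ n, C'.gate (φ n) = (C.gate n).map ι φ) {T : VTree X} {u : N} (h : C.IsSDD T u) :
    C'.IsSDD (T.map ι) (φ u) := by
  induction h with
  | @const T u b hg => exact .const (b := b) (by rw [hφ, hg]; rfl)
  | @lit T u x b hg hx =>
    refine .lit (x := ι x) (b := b) (by rw [hφ, hg]; rfl) ?_
    change ι x ∈ (T.map ι).leaves
    rw [VTree.leaves_map]
    exact List.mem_map_of_mem hx
  | @decomposition T vl vr u cs prime sub hg hv h1 _ _ h4 h5 h6 ih2 ih3 =>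
    have hgφ : ∀ g ∈ cs, C'.gate (φ g) = .and (φ (prime g)) (φ (sub g)) := by
      intro g hgc; rw [hφ, h1 g hgc]; rfl
    refine .of_decomposition (cs := φ '' cs) (by rw [hφ, hg]; rfl) (hv.map (ι := ι)) ?_ ?_ ?_
    · rintro _ ⟨g, hgc, rfl⟩
      refine ⟨_, _, hgφ g hgc, ih2 g hgc, ih3 g hgc, ?_⟩
      obtain ⟨a, ha⟩ := h4 g hgc
      -- Variables outside the range of `ι` do not matter; injectivity makes the extension restrict
      -- to `a`.
      refine ⟨Function.extend ι a fun _ => false, (sat_map_iff hφ).2 ?_⟩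
      rwa [Function.extend_comp hι]
    · rintro _ ⟨g, hgc, rfl⟩ _ ⟨h, hhc, rfl⟩ l r l' r' a hlr hlr' hs hs'
      rw [hgφ g hgc] at hlr
      rw [hgφ h hhc] at hlr'
      cases hlr; cases hlr'
      by_contra hne
      exact h5 g hgc h hhc (fun h => hne (h ▸ rfl)) _
        ⟨(sat_map_iff hφ).1 hs, (sat_map_iff hφ).1 hs'⟩
    · intro a
      obtain ⟨g, hgc, hs⟩ := h6 (a ∘ ι)
      exact ⟨φ g, ⟨g, hgc, rfl⟩, _, _, hgφ g hgc, (sat_map_iff hφ).2 hs⟩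

theorem IsSDD.of_map {C' : Circuit X N'} (hinj : Function.Injective φ)
    (hφ : ∀ n, C'.gate (φ n) = (C.gate n).map id φ) {T : VTree X} {u : N}
    (h : C'.IsSDD T (φ u)) : C.IsSDD T u := by
  generalize hn : φ u = n at h
  induction h generalizing u with
  | const hg =>
    subst hn; rw [hφ] at hg
    cases hu : C.gate u <;> simp only [hu, Gate.map] at hg <;> cases hg
    exact .const hu
  | lit hg hx =>
    subst hn; rw [hφ] at hg
    cases hu : C.gate u <;> simp only [hu, Gate.map] at hg <;> cases hg
    exact .lit hu hx
  | decomposition prime sub hg hv h1 _ _ h4 h5 h6 ih2 ih3 =>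
    subst hn; rw [hφ] at hg
    rcases hu : C.gate u with b | ⟨x, b⟩ | ⟨l, r⟩ | cs <;>
      simp only [hu, Gate.map] at hg <;> cases hg
    -- Primes and subs of image gates are again images, since labels in the image of `φ` are mapped
    -- labels.
    have hw : ∀ g ∈ cs, ∃ l r, C.gate g = .and l r ∧ φ l = prime (φ g) ∧ φ r = sub (φ g) := by
      intro g hgc
      have := h1 _ ⟨g, hgc, rfl⟩
      rw [hφ] at this
      rcases hgg : C.gate g with b | ⟨x, b⟩ | ⟨l, r⟩ | ds <;>
        simp only [hgg, Gate.map, reduceCtorEq, Gate.and.injEq] at this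
      exact ⟨_, _, rfl, this⟩
    refine .of_decomposition hu hv ?_ ?_ ?_
    · intro g hgc
      obtain ⟨l, r, hlr, hl, hr⟩ := hw g hgc
      refine ⟨l, r, hlr, ih2 _ ⟨g, hgc, rfl⟩ hl, ih3 _ ⟨g, hgc, rfl⟩ hr, ?_⟩
      obtain ⟨a, ha⟩ := h4 _ ⟨g, hgc, rfl⟩
      rw [← hl] at ha
      exact ⟨a, .of_map hφ ha⟩
    · intro g hgc h hhc l r l' r' a hlr hlr' hs hs'
      obtain ⟨_, _, e, hl, _⟩ := hw g hgc
      rw [hlr] at e; cases e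
      obtain ⟨_, _, e, hl', _⟩ := hw h hhc
      rw [hlr'] at e; cases e
      by_contra hne
      refine h5 _ ⟨g, hgc, rfl⟩ _ ⟨h, hhc, rfl⟩ (fun h => hne (hinj h)) a ?_
      rw [← hl, ← hl']
      exact ⟨.map (ι := id) hφ hs, .map (ι := id) hφ hs'⟩
    · intro a
      obtain ⟨_, ⟨g, hgc, rfl⟩, hs⟩ := h6 a
      obtain ⟨l, r, hlr, hl, _⟩ := hw g hgc
      rw [← hl] at hs
      exact ⟨g, hgc, l, r, hlr, .of_map hφ hs⟩

end Circuit

/-! ### Removing unreachable nodes -/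

namespace NNF

variable {X N : Type*} (D : NNF X N)

theorem gate_val_trim (n : {u : N // D.Reach D.root u}) :
    D.gate n.1 = (D.trim.gate n).map id Subtype.val := by
  obtain ⟨n, hn⟩ := n
  unfold trim
  dsimp only
  split
  · simpa [Gate.map]
  · simpa [Gate.map]
  · simpa [Gate.map]
  · rename_i cs h
    rw [h]
    simp only [Gate.map, Gate.or.injEq]
    ext c
    simp only [Set.mem_image, Set.mem_ofPred_eq, Subtype.exists, exists_and_left, exists_prop,
      exists_eq_right_right]
    -- Every child of a reachable gate is reachable, so trimming loses no input.
    exact ⟨fun hc => ⟨hc, hn.tail (Circuit.child_of_or h hc)⟩, fun hc => hc.1⟩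

theorem sat_trim {a : X → Bool} {n : {u : N // D.Reach D.root u}} :
    D.trim.Sat a n ↔ D.Sat a n.1 :=
  (Circuit.sat_map_iff (ι := id) D.gate_val_trim).symm

theorem isSDD_trim {T : VTree X} {n : {u : N // D.Reach D.root u}} (h : D.IsSDD T n.1) :
    D.trim.IsSDD T n :=
  .of_map Subtype.val_injective D.gate_val_trim h

end NNF

/-! ## Smooth and simple structured d-DNNFs -/

/-- Smooth and simple structured d-DNNFs that satisfy the conventions on circuits. -/
structure NNF.Regular {X N : Type*} (D : NNF X N) (T : VTree X) : Prop where
  nodup : T.leaves.Nodup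
  vars_univ : T.vars = Set.univ
  structured : D.IsStructuredDDNNF T
  smooth : D.Smooth
  simple : D.Simple
  proper : D.Proper

namespace NNF.Regular

variable {X N : Type*} {D : NNF X N} {T : VTree X}

theorem not_const_of_child (hD : D.Regular T) {u w : N} (h : D.Child u w) (b : Bool) :
    D.gate w ≠ .const b := by
  rcases Circuit.child_cases h with ⟨l, r, hg, rfl | rfl⟩ | ⟨cs, hg, hw⟩
  · exact (hD.proper.no_and_const u _ r hg b).1
  · exact (hD.proper.no_and_const u l _ hg b).2
  · exact hD.simple.no_or_const u cs hg w hw b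

/-- A constant root has no outgoing wires, so connectedness would leave it as the only node. -/
theorem root_not_const (hD : D.Regular T) {u : N} (hu : ∀ b, D.gate u ≠ .const b) (b : Bool) :
    D.gate D.root ≠ .const b := by
  intro hr
  rcases (hD.proper.connected u).cases_head with h | ⟨w, hw, _⟩
  · exact hu b (h ▸ hr)
  · simp [Circuit.Child, hr] at hw

theorem exists_sat (hD : D.Regular T) {u : N} (hu : ∀ b, D.gate u ≠ .const b) :
    ∃ a, D.Sat a u := by
  by_contra h
  push Not at h
  exact hu false (hD.simple.bot_only u h)

theorem or_nonempty (hD : D.Regular T) {u : N} {cs : Set N} (h : D.gate u = .or cs) :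
    cs.Nonempty := by
  obtain ⟨a, ha⟩ := hD.exists_sat (u := u) (by simp [h])
  obtain ⟨c, hc, _⟩ := (Circuit.sat_or h).1 ha
  exact ⟨c, hc⟩

theorem vars_or_child (hD : D.Regular T) {u c : N} {cs : Set N} (h : D.gate u = .or cs)
    (hc : c ∈ cs) : D.vars c = D.vars u := by
  refine (Circuit.vars_subset_of_child (Circuit.child_of_or h hc)).antisymm ?_
  rw [Circuit.vars_or h]
  exact Set.iUnion₂_subset fun d hd => (hD.smooth u cs h d hd c hc).le

theorem vars_nonempty (hD : D.Regular T) {u : N} (hu : ∀ b, D.gate u ≠ .const b) :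
    (D.vars u).Nonempty := by
  induction u using hD.structured.acyclic.induction with
  | _ u ih =>
    rcases hg : D.gate u with b | ⟨x, b⟩ | ⟨l, r⟩ | cs
    · exact absurd hg (hu b)
    · rw [Circuit.vars_lit hg]; exact Set.singleton_nonempty x
    · have hl := Circuit.child_of_and_left hg
      exact (ih l hl (hD.not_const_of_child hl)).mono (Circuit.vars_subset_of_child hl)
    · obtain ⟨c, hc⟩ := hD.or_nonempty hg
      have hl := Circuit.child_of_or hg hc
      exact (ih c hl (hD.not_const_of_child hl)).mono (Circuit.vars_subset_of_child hl)

/-! ### Decomposition nodes are determined by variable sets -/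

theorem left_nonempty (hD : D.Regular T) {u l r : N} (hg : D.gate u = .and l r) :
    (D.vars l).Nonempty :=
  hD.vars_nonempty (hD.not_const_of_child (Circuit.child_of_and_left hg))

theorem right_nonempty (hD : D.Regular T) {u l r : N} (hg : D.gate u = .and l r) :
    (D.vars r).Nonempty :=
  hD.vars_nonempty (hD.not_const_of_child (Circuit.child_of_and_right hg))

/-- Both children of `u` have variables, so `u` meets both sides of `w`. Hence `v` cannot lie
strictly below `w`; and if `w` lies below `v`, it already contains all variables of `u`, which are
those of `v`. -/
theorem eq_of_respectsNode (hD : D.Regular T) {u : N} {v w : VTree X} (hv : v.Subtree T)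
    (hw : w.Subtree T) (huv : D.vars u = v.vars) (huw : D.RespectsNode u w) : w = v := by
  obtain ⟨l, r, wl, wr, hg, rfl, hl, hr⟩ := huw
  obtain ⟨x, hx⟩ := hD.left_nonempty hg
  obtain ⟨y, hy⟩ := hD.right_nonempty hg
  have hu := Circuit.vars_and hg
  have hd := Set.disjoint_left.1 (VTree.disjoint_vars (hw.nodup hD.nodup))
  have hxv : x ∈ v.vars := huv ▸ hu ▸ .inl hx
  have hyv : y ∈ v.vars := huv ▸ hu ▸ .inr hy
  have hxw : x ∈ (VTree.node wl wr).vars := VTree.vars_node wl wr ▸ .inl (hl hx)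
  rcases hv.comparable hD.nodup hw hxv hxw with h | h
  · rcases h with h | h | h
    · exact h.symm
    · exact absurd (hr hy) (hd (h.vars_subset hyv))
    · exact absurd (h.vars_subset hxv) (hd (hl hx))
  · refine h.eq_of_vars_subset (hv.nodup hD.nodup) ?_
    rw [← huv, hu, VTree.vars_node]
    exact Set.union_subset_union hl hr

/-- Respecting `v` gives only inclusions. They are equalities because the two sides of `v` are
disjoint and `u` misses no variable of `v`. -/
theorem and_children (hD : D.Regular T) {u l r : N} {v : VTree X} (hg : D.gate u = .and l r)
    (hv : v.Subtree T) (huv : D.vars u = v.vars) :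
    ∃ vl vr, v = .node vl vr ∧ D.vars l = vl.vars ∧ D.vars r = vr.vars := by
  obtain ⟨w, hw, hr⟩ := hD.structured.respects u l r hg
  obtain rfl := hD.eq_of_respectsNode hv hw huv hr
  obtain ⟨l', r', vl, vr, hg', rfl, hl, hr⟩ := hr
  rw [hg] at hg'; cases hg'
  have hd := Set.disjoint_left.1 (VTree.disjoint_vars (hv.nodup hD.nodup))
  rw [Circuit.vars_and hg, VTree.vars_node] at huv
  refine ⟨vl, vr, rfl, hl.antisymm fun x hx => ?_, hr.antisymm fun x hx => ?_⟩
  · exact (huv.ge (.inl hx)).resolve_right fun h => hd hx (hr h)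
  · exact (huv.ge (.inr hx)).resolve_left fun h => hd (hl h) hx

/-- The root mentions all of `T`. Along a path from it, `and_children` handles ∧-gates and
smoothness handles ∨-gates. -/
theorem exists_vars_eq (hD : D.Regular T) {u : N} (hu : ∀ b, D.gate u ≠ .const b) :
    ∃ v : VTree X, v.Subtree T ∧ D.vars u = v.vars := by
  have hroot := hD.root_not_const hu
  clear hu
  induction hD.proper.connected u with
  | refl =>
    refine ⟨T, .refl T, ?_⟩
    rcases hD.proper.mentions_all with ⟨b, hb⟩ | h
    · exact absurd hb (hroot b)
    · rw [h, hD.vars_univ]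
  | tail _ hc ih =>
    obtain ⟨v, hv, huv⟩ := ih
    rcases Circuit.child_cases hc with ⟨l, r, hg, h⟩ | ⟨cs, hg, h⟩
    · obtain ⟨vl, vr, rfl, hl, hr⟩ := hD.and_children hg hv huv
      rcases h with rfl | rfl
      · exact ⟨vl, (VTree.subtree_node_left _ _).trans hv, hl⟩
      · exact ⟨vr, (VTree.subtree_node_right _ _).trans hv, hr⟩
    · exact ⟨v, hv, (hD.vars_or_child hg h).trans huv⟩

theorem isDNode_of_vars_eq (hD : D.Regular T) {u : N} {v : VTree X} (hv : v.Subtree T)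
    (h : D.vars u = v.vars) : D.IsDNode T u v := by
  induction u using hD.structured.acyclic.induction generalizing v with
  | _ u ih =>
    rcases hg : D.gate u with b | ⟨x, b⟩ | ⟨l, r⟩ | cs
    · rw [Circuit.vars_const hg] at h
      exact absurd h.symm v.vars_nonempty.ne_empty
    · rw [Circuit.vars_lit hg] at h
      obtain rfl := VTree.eq_leaf_of_vars (hv.nodup hD.nodup) h.symm
      exact .lit hg hv
    · obtain ⟨vl, vr, rfl, hl, hr⟩ := hD.and_children hg hv h
      exact .and hv ⟨l, r, vl, vr, hg, rfl, hl.le, hr.le⟩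
        fun w hw hr => hD.eq_of_respectsNode hv (hw.trans hv) h hr
    · exact .or hg (hD.or_nonempty hg) fun c hc =>
        ih c (Circuit.child_of_or hg hc) hv ((hD.vars_or_child hg hc).trans h)

/-- This replaces the recursive definition of decomposition nodes everywhere below. -/
theorem isDNode_iff (hD : D.Regular T) {u : N} {v : VTree X} :
    D.IsDNode T u v ↔ v.Subtree T ∧ D.vars u = v.vars := by
  refine ⟨fun h => ?_, fun h => hD.isDNode_of_vars_eq h.1 h.2⟩
  induction h with
  | lit hg hv => exact ⟨hv, by rw [Circuit.vars_lit hg, VTree.vars_leaf]⟩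
  | @and u w hw hr _ =>
    refine ⟨hw, ?_⟩
    obtain ⟨v, hv, huv⟩ := hD.exists_vars_eq (u := u) (by
      obtain ⟨l, r, vl, vr, hg, _⟩ := hr
      simp [hg])
    obtain rfl := hD.eq_of_respectsNode hv hw huv hr
    exact huv
  | or hg hne _ ih =>
    obtain ⟨c, hc⟩ := hne
    obtain ⟨h1, h2⟩ := ih c hc
    exact ⟨h1, (hD.vars_or_child hg hc).symm.trans h2⟩

theorem isDNode_unique (hD : D.Regular T) {u : N} {v w : VTree X} (hv : D.IsDNode T u v)
    (hw : D.IsDNode T u w) : v = w := by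
  rw [hD.isDNode_iff] at hv hw
  exact hv.1.eq_of_vars_eq hD.nodup hw.1 (hv.2.symm.trans hw.2)

theorem exists_isDNode (hD : D.Regular T) {u : N} (hu : ∀ b, D.gate u ≠ .const b) :
    ∃ v, D.IsDNode T u v := by
  obtain ⟨v, hv⟩ := hD.exists_vars_eq hu
  exact ⟨v, hD.isDNode_iff.2 hv⟩

theorem not_const_of_isDNode {u : N} {v : VTree X} (h : D.IsDNode T u v) (b : Bool) :
    D.gate u ≠ .const b := by
  cases h with
  | lit hg _ => simp [hg]
  | and _ hr _ => obtain ⟨l, r, vl, vr, hg, _⟩ := hr; simp [hg]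
  | or hg _ _ => simp [hg]

theorem dnode_eq (hD : D.Regular T) {u : N} {v : VTree X} (h : D.IsDNode T u v) :
    D.dnode T u = v := by
  have hex : ∃ v, D.IsDNode T u v := ⟨v, h⟩
  unfold Circuit.dnode
  rw [dif_pos hex]
  exact hD.isDNode_unique hex.choose_spec h

theorem isDNode_and (hD : D.Regular T) {u l r : N} {v : VTree X} (hg : D.gate u = .and l r)
    (h : D.IsDNode T u v) :
    ∃ vl vr, v = .node vl vr ∧ D.IsDNode T l vl ∧ D.IsDNode T r vr := by
  rw [hD.isDNode_iff] at h
  obtain ⟨vl, vr, rfl, hl, hr⟩ := hD.and_children hg h.1 h.2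
  exact ⟨vl, vr, rfl,
    hD.isDNode_of_vars_eq ((VTree.subtree_node_left _ _).trans h.1) hl,
    hD.isDNode_of_vars_eq ((VTree.subtree_node_right _ _).trans h.1) hr⟩

theorem isDNode_or (hD : D.Regular T) {u c : N} {cs : Set N} {v : VTree X}
    (hg : D.gate u = .or cs) (hc : c ∈ cs) (h : D.IsDNode T u v) : D.IsDNode T c v := by
  rw [hD.isDNode_iff] at h ⊢
  exact ⟨h.1, (hD.vars_or_child hg hc).trans h.2⟩

theorem isDNode_lit (hD : D.Regular T) {u : N} {x : X} {b : Bool} {v : VTree X}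
    (hg : D.gate u = .lit x b) (h : D.IsDNode T u v) : v = .leaf x := by
  rw [hD.isDNode_iff, Circuit.vars_lit hg] at h
  exact VTree.eq_leaf_of_vars (h.1.nodup hD.nodup) h.2.symm

/-- The variables of a child of a conjunction are a proper subset. -/
theorem not_vars_subset_of_and_child (hD : D.Regular T) {u l r w : N}
    (hg : D.gate u = .and l r) (hw : w = l ∨ w = r) : ¬ D.vars u ⊆ D.vars w := by
  have hd := Set.disjoint_left.1 (hD.structured.decomposable u l r hg)
  rw [Circuit.vars_and hg]
  intro hs
  rcases hw with rfl | rfl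
  · obtain ⟨x, hx⟩ := hD.right_nonempty hg
    exact hd (hs (.inr hx)) hx
  · obtain ⟨x, hx⟩ := hD.left_nonempty hg
    exact hd hx (hs (.inl hx))

/-! ### Satisfied paths -/

/-- A satisfied node leads to a satisfied gate other than a disjunction at every vtree node
below its own. -/
theorem exists_satPath (hD : D.Regular T) {a : X → Bool} {u : N} {v w : VTree X}
    (hs : D.Sat a u) (hu : D.IsDNode T u w) (hv : v.Subtree w) :
    ∃ n, D.SatPath a u n ∧ D.Sat a n ∧ D.IsDNode T n v ∧ ∀ cs, D.gate n ≠ .or cs := by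
  induction u using hD.structured.acyclic.induction generalizing w with
  | _ u ih =>
    have step : ∀ c w', D.Child u c → D.Sat a c → D.IsDNode T c w' → v.Subtree w' →
        ∃ n, D.SatPath a u n ∧ D.Sat a n ∧ D.IsDNode T n v ∧ ∀ cs, D.gate n ≠ .or cs := by
      intro c w' hc hsc hdc hvc
      obtain ⟨n, h1, h2⟩ := ih c hc hsc hdc hvc
      exact ⟨n, .head ⟨hc, hsc⟩ h1, h2⟩
    rcases hg : D.gate u with b | ⟨x, b⟩ | ⟨l, r⟩ | cs
    · exact absurd hg (not_const_of_isDNode hu b)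
    · obtain rfl := hD.isDNode_lit hg hu
      obtain rfl : v = .leaf x := hv
      exact ⟨u, .refl, hs, hu, by simp [hg]⟩
    · obtain ⟨vl, vr, rfl, hl, hr⟩ := hD.isDNode_and hg hu
      rw [Circuit.sat_and hg] at hs
      rcases hv with rfl | hv | hv
      · exact ⟨u, .refl, (Circuit.sat_and hg).2 hs, hu, by simp [hg]⟩
      · exact step l vl (Circuit.child_of_and_left hg) hs.1 hl hv
      · exact step r vr (Circuit.child_of_and_right hg) hs.2 hr hv
    · obtain ⟨c, hc, hsc⟩ := (Circuit.sat_or hg).1 hs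
      exact step c w (Circuit.child_of_or hg hc) hsc (hD.isDNode_or hg hc hu) hv

/-- A path leaving an ∧-gate loses variables at once, so it never returns to the same vtree node. -/
theorem eq_of_satPath_self (hD : D.Regular T) {a : X → Bool} {u n : N} {v : VTree X}
    (hu : ∀ cs, D.gate u ≠ .or cs) (h : D.SatPath a u n) (hdu : D.IsDNode T u v)
    (hdn : D.IsDNode T n v) : u = n := by
  rcases h.cases_head with h | ⟨c, ⟨hc, _⟩, h⟩
  · exact h
  · rcases Circuit.child_cases hc with ⟨l, r, hg, h'⟩ | ⟨cs, hg, _⟩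
    · refine absurd ?_ (hD.not_vars_subset_of_and_child hg h')
      rw [(hD.isDNode_iff.1 hdu).2, ← (hD.isDNode_iff.1 hdn).2]
      exact Circuit.vars_subset_of_reach (Circuit.SatPath.reach h)
    · exact absurd hg (hu cs)

/-- There is at most one such gate. -/
theorem satPath_unique (hD : D.Regular T) {a : X → Bool} {u m n : N} {v : VTree X}
    (hm : D.SatPath a u m) (hn : D.SatPath a u n) (hdm : D.IsDNode T m v)
    (hdn : D.IsDNode T n v) (hm' : ∀ cs, D.gate m ≠ .or cs) (hn' : ∀ cs, D.gate n ≠ .or cs) :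
    m = n := by
  induction u using hD.structured.acyclic.induction with
  | _ u ih =>
    rcases hm.cases_head with rfl | ⟨c, ⟨hc, hsc⟩, hcm⟩
    · exact hD.eq_of_satPath_self hm' hn hdm hdn
    rcases hn.cases_head with rfl | ⟨d, ⟨hd, hsd⟩, hdn'⟩
    · exact (hD.eq_of_satPath_self hn' hm hdn hdm).symm
    -- The paths start with the same wire. At an ∧-gate both children see the variables of `v`,
    -- contradicting decomposability if they differ; at an ∨-gate both are satisfied, contradicting
    -- determinism.
    have hcd : c = d := by
      rcases Circuit.child_cases hc with ⟨l, r, hg, h⟩ | ⟨cs, hg, h⟩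
      · have hd' : d = l ∨ d = r := by simpa [Circuit.Child, hg] using hd
        have h1 := Circuit.vars_subset_of_reach (Circuit.SatPath.reach hcm)
        have h2 := Circuit.vars_subset_of_reach (Circuit.SatPath.reach hdn')
        rw [(hD.isDNode_iff.1 hdm).2] at h1
        rw [(hD.isDNode_iff.1 hdn).2] at h2
        obtain ⟨x, hx⟩ := v.vars_nonempty
        have hdis := Set.disjoint_left.1 (hD.structured.decomposable u l r hg)
        rcases h with rfl | rfl <;> rcases hd' with rfl | rfl
        · rfl
        · exact absurd (h2 hx) (hdis (h1 hx))
        · exact absurd (h1 hx) (hdis (h2 hx))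
        · rfl
      · have hd' : d ∈ cs := by simpa [Circuit.Child, hg] using hd
        by_contra hne
        exact hD.structured.deterministic u cs hg c h d hd' hne a ⟨hsc, hsd⟩
    subst hcd
    exact ih c hc hcm hdn'

/-! ### Restrictions -/

theorem satUnder_of_inRestriction {A : Set X} {p : X → Bool} {u : N}
    (h : D.InRestriction A p u) : D.SatUnder A p u := by
  cases h with
  | root h => exact h
  | child _ _ h => exact h

/-- Satisfaction travels up to the root. At an ∧-gate the sibling of the path contains no variable
of `v`, so `p` alone decides its value; it is true because the ∧-gate survives the restriction. -/
theorem satPath_of_inRestriction (hD : D.Regular T) {v : VTree X} {a p : X → Bool} {w : N}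
    (h : D.InRestriction v.shell p w) (hv : v.vars ⊆ D.vars w) (hap : ∀ x ∈ v.shell, a x = p x)
    (hs : D.Sat a w) : D.Sat a D.root ∧ D.SatPath a D.root w := by
  induction h with
  | root _ => exact ⟨hs, .refl⟩
  | @child u w hu hc _ ih =>
    have hsu : D.Sat a u := by
      rcases Circuit.child_cases hc with ⟨l, r, hg, h⟩ | ⟨cs, hg, h⟩
      · obtain ⟨a', ha', hs'⟩ := satUnder_of_inRestriction hu
        have hd := Set.disjoint_left.1 (hD.structured.decomposable u l r hg)
        rw [Circuit.sat_and hg] at hs' ⊢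
        rcases h with rfl | rfl
        · refine ⟨hs, hs'.2.congr fun x hx => ?_⟩
          have hx' : x ∈ v.shell := fun h => hd (hv h) hx
          rw [ha' x hx', hap x hx']
        · refine ⟨hs'.1.congr fun x hx => ?_, hs⟩
          have hx' : x ∈ v.shell := fun h => hd hx (hv h)
          rw [ha' x hx', hap x hx']
      · exact .or hg h hs
    obtain ⟨h1, h2⟩ := ih (hv.trans (Circuit.vars_subset_of_child hc)) hsu
    exact ⟨h1, h2.tail ⟨hc, hs⟩⟩

theorem inRestriction_of_satPath {A : Set X} {a p : X → Bool} {w : N}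
    (hap : ∀ x ∈ A, a x = p x) (hr : D.Sat a D.root) (h : D.SatPath a D.root w) :
    D.InRestriction A p w := by
  induction h with
  | refl => exact .root ⟨a, hap, hr⟩
  | tail _ hc ih => exact .child ih hc.1 ⟨a, hap, hc.2⟩

open Classical in
/-- Every node other than a constant is reached by a satisfied path. -/
theorem exists_satPath_of_reach (hD : D.Regular T) {u w : N} (h : D.Reach u w)
    (hw : ∀ b, D.gate w ≠ .const b) : ∃ a, D.Sat a u ∧ D.SatPath a u w := by
  induction h using Relation.ReflTransGen.head_induction_on with
  | refl =>
    obtain ⟨a, ha⟩ := hD.exists_sat hw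
    exact ⟨a, ha, .refl⟩
  | @head u c hc _ ih =>
    obtain ⟨a, ha, hp⟩ := ih
    rcases Circuit.child_cases hc with ⟨l, r, hg, h⟩ | ⟨cs, hg, h⟩
    · have hd := Set.disjoint_left.1 (hD.structured.decomposable u l r hg)
      -- Here `d` is the sibling of `c`. Their variables are disjoint, so satisfying assignments of
      -- the two can be glued.
      obtain ⟨d, hd1, hd2⟩ : ∃ d, (∀ x ∈ D.vars d, x ∉ D.vars c) ∧
          (∃ b, D.Sat b d) ∧ ∀ b, D.Sat b c → D.Sat b d → D.Sat b u := by
        rcases h with rfl | rfl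
        · exact ⟨r, fun x hx hx' => hd hx' hx,
            hD.exists_sat (hD.not_const_of_child (Circuit.child_of_and_right hg)),
            fun b h1 h2 => .and hg h1 h2⟩
        · exact ⟨l, fun x hx hx' => hd hx hx',
            hD.exists_sat (hD.not_const_of_child (Circuit.child_of_and_left hg)),
            fun b h1 h2 => .and hg h2 h1⟩
      obtain ⟨⟨b, hb⟩, hsat⟩ := hd2
      let e : X → Bool := fun x => if x ∈ D.vars c then a x else b x
      have he : ∀ x ∈ D.vars c, a x = e x := fun x hx => by simp [e, hx]
      have he' : ∀ x ∈ D.vars d, b x = e x := fun x hx => by simp [e, hd1 x hx]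
      exact ⟨e, hsat e (ha.congr he) (hb.congr he'), .head ⟨hc, ha.congr he⟩ (hp.congr he)⟩
    · exact ⟨a, .or hg h ha, .head ⟨hc, ha⟩ hp⟩

theorem exists_mem_R (hD : D.Regular T) {u : N} {v : VTree X} (h : D.IsDNode T u v) :
    ∃ p, u ∈ D.R T p v := by
  obtain ⟨a, ha, hp⟩ := hD.exists_satPath_of_reach (hD.proper.connected u)
    (not_const_of_isDNode h)
  exact ⟨a, inRestriction_of_satPath (fun _ _ => rfl) ha hp, h⟩

/-- By smoothness `c` mentions only `vars(v)`, so no shell restriction can make it ⊥. -/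
theorem mem_R_of_or (hD : D.Regular T) {u c : N} {cs : Set N} {p : X → Bool} {v : VTree X}
    (hg : D.gate u = .or cs) (hc : c ∈ cs) (hu : u ∈ D.R T p v) : c ∈ D.R T p v := by
  classical
  have hdc := hD.isDNode_or hg hc hu.2
  refine ⟨.child hu.1 (Circuit.child_of_or hg hc) ?_, hdc⟩
  obtain ⟨b, hb⟩ := hD.exists_sat (not_const_of_isDNode hdc)
  refine ⟨fun x => if x ∈ v.vars then b x else p x, fun x hx => if_neg hx,
    hb.congr fun x hx => ?_⟩
  rw [(hD.isDNode_iff.1 hdc).2] at hx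
  rw [if_pos hx]

/-- A disjunction in `R` has a child, and all its children stay in `R`; the children of a
conjunction have strictly fewer variables. -/
theorem mem_RPlus_iff (hD : D.Regular T) {u : N} {p : X → Bool} {v : VTree X} :
    u ∈ D.RPlus T p v ↔ u ∈ D.R T p v ∧ ∀ cs, D.gate u ≠ .or cs := by
  refine and_congr_right fun hu => ⟨fun h cs hg => ?_, fun h w hc hw => ?_⟩
  · obtain ⟨c, hc⟩ := hD.or_nonempty hg
    exact h c (Circuit.child_of_or hg hc) (hD.mem_R_of_or hg hc hu)
  · rcases Circuit.child_cases hc with ⟨l, r, hg, h'⟩ | ⟨cs, hg, _⟩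
    · refine hD.not_vars_subset_of_and_child hg h' ?_
      rw [(hD.isDNode_iff.1 hu.2).2, (hD.isDNode_iff.1 hw.2).2]
    · exact h cs hg

theorem exists_mem_RPlus (hD : D.Regular T) {a p : X → Bool} {v : VTree X}
    (hv : v.Subtree T) (hap : ∀ x ∈ v.shell, a x = p x) (hs : D.Sat a D.root)
    (hr : ∀ b, D.gate D.root ≠ .const b) : ∃ w ∈ D.RPlus T p v, D.Sat a w := by
  have hroot : D.IsDNode T D.root T := by
    refine hD.isDNode_of_vars_eq (.refl T) ?_
    rcases hD.proper.mentions_all with ⟨b, hb⟩ | h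
    · exact absurd hb (hr b)
    · rw [h, hD.vars_univ]
  obtain ⟨w, h1, h2, h3, h4⟩ := hD.exists_satPath hs hroot hv
  exact ⟨w, hD.mem_RPlus_iff.2 ⟨⟨inRestriction_of_satPath hap hs h1, h3⟩, h4⟩, h2⟩

theorem satPath_of_mem_R (hD : D.Regular T) {a p : X → Bool} {v : VTree X} {w : N}
    (hw : w ∈ D.R T p v) (hap : ∀ x ∈ v.shell, a x = p x) (hs : D.Sat a w) :
    D.Sat a D.root ∧ D.SatPath a D.root w :=
  hD.satPath_of_inRestriction hw.1 (hD.isDNode_iff.1 hw.2).2.ge hap hs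

/-- Both gates end satisfied paths from the root, so uniqueness of such gates applies. -/
theorem RPlus_disjoint (hD : D.Regular T) {a p : X → Bool} {v : VTree X} {m n : N}
    (hm : m ∈ D.RPlus T p v) (hn : n ∈ D.RPlus T p v) (hap : ∀ x ∈ v.shell, a x = p x)
    (hsm : D.Sat a m) (hsn : D.Sat a n) : m = n := by
  rw [hD.mem_RPlus_iff] at hm hn
  exact hD.satPath_unique (hD.satPath_of_mem_R hm.1 hap hsm).2
    (hD.satPath_of_mem_R hn.1 hap hsn).2 hm.1.2 hn.1.2 hm.2 hn.2

end NNF.Regular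

/-! ## Circuits for a function and its complement -/

/-- Circuits for a function and for its complement. -/
structure ComplementaryPair {X V W : Type*} (D : NNF X V) (Dc : NNF X W) (T : VTree X) :
    Prop where
  left : D.Regular T
  right : Dc.Regular T
  root_iff : ∀ a, D.Sat a D.root ↔ ¬ Dc.Sat a Dc.root

section Pair

variable {X V W : Type*} {D : NNF X V} {Dc : NNF X W} {T : VTree X}

theorem both_const {u : V ⊕ W} {b : Bool} (h : (both D Dc).gate u = .const b) :
    (∃ u', u = .inl u' ∧ D.gate u' = .const b) ∨ ∃ u', u = .inr u' ∧ Dc.gate u' = .const b := by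
  rcases u with u | u
  · refine .inl ⟨u, rfl, ?_⟩
    change (D.gate u).map id Sum.inl = _ at h
    cases hg : D.gate u <;> simp_all [Gate.map]
  · refine .inr ⟨u, rfl, ?_⟩
    change (Dc.gate u).map id Sum.inr = _ at h
    cases hg : Dc.gate u <;> simp_all [Gate.map]

theorem both_lit {u : V ⊕ W} {x : X} {b : Bool} (h : (both D Dc).gate u = .lit x b) :
    (∃ u', u = .inl u' ∧ D.gate u' = .lit x b) ∨ ∃ u', u = .inr u' ∧ Dc.gate u' = .lit x b := by
  rcases u with u | u
  · refine .inl ⟨u, rfl, ?_⟩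
    change (D.gate u).map id Sum.inl = _ at h
    cases hg : D.gate u <;> simp_all [Gate.map]
  · refine .inr ⟨u, rfl, ?_⟩
    change (Dc.gate u).map id Sum.inr = _ at h
    cases hg : Dc.gate u <;> simp_all [Gate.map]

theorem both_and {u l r : V ⊕ W} (h : (both D Dc).gate u = .and l r) :
    (∃ u' l' r', u = .inl u' ∧ l = .inl l' ∧ r = .inl r' ∧ D.gate u' = .and l' r') ∨
      ∃ u' l' r', u = .inr u' ∧ l = .inr l' ∧ r = .inr r' ∧ Dc.gate u' = .and l' r' := by
  rcases u with u | u
  · left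
    change (D.gate u).map id Sum.inl = _ at h
    rcases hg : D.gate u with b | ⟨x, b⟩ | ⟨l', r'⟩ | cs <;> rw [hg] at h <;> cases h
    exact ⟨u, l', r', rfl, rfl, rfl, hg⟩
  · right
    change (Dc.gate u).map id Sum.inr = _ at h
    rcases hg : Dc.gate u with b | ⟨x, b⟩ | ⟨l', r'⟩ | cs <;> rw [hg] at h <;> cases h
    exact ⟨u, l', r', rfl, rfl, rfl, hg⟩

theorem both_or {u : V ⊕ W} {cs : Set (V ⊕ W)} (h : (both D Dc).gate u = .or cs) :
    (∃ u' cs', u = .inl u' ∧ cs = Sum.inl '' cs' ∧ D.gate u' = .or cs') ∨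
      ∃ u' cs', u = .inr u' ∧ cs = Sum.inr '' cs' ∧ Dc.gate u' = .or cs' := by
  rcases u with u | u
  · left
    change (D.gate u).map id Sum.inl = _ at h
    rcases hg : D.gate u with b | ⟨x, b⟩ | ⟨l', r'⟩ | cs' <;> rw [hg] at h <;> cases h
    exact ⟨u, cs', rfl, rfl, hg⟩
  · right
    change (Dc.gate u).map id Sum.inr = _ at h
    rcases hg : Dc.gate u with b | ⟨x, b⟩ | ⟨l', r'⟩ | cs' <;> rw [hg] at h <;> cases h
    exact ⟨u, cs', rfl, rfl, hg⟩

theorem both_or_iff_inl {u : V} :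
    (∀ cs, (both D Dc).gate (.inl u) ≠ .or cs) ↔ ∀ cs, D.gate u ≠ .or cs := by
  refine ⟨fun h cs hg => h (Sum.inl '' cs) ?_, fun h cs hg => ?_⟩
  · change (D.gate u).map id Sum.inl = _
    rw [hg]; rfl
  · rcases both_or hg with ⟨_, cs', hu, _, hg'⟩ | ⟨_, _, hu, _, _⟩
    · cases hu; exact h cs' hg'
    · cases hu

theorem both_or_iff_inr {u : W} :
    (∀ cs, (both D Dc).gate (.inr u) ≠ .or cs) ↔ ∀ cs, Dc.gate u ≠ .or cs := by
  refine ⟨fun h cs hg => h (Sum.inr '' cs) ?_, fun h cs hg => ?_⟩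
  · change (Dc.gate u).map id Sum.inr = _
    rw [hg]; rfl
  · rcases both_or hg with ⟨_, _, hu, _, _⟩ | ⟨_, cs', hu, _, hg'⟩
    · cases hu
    · cases hu; exact h cs' hg'

theorem sat_both {a : X → Bool} {u : V ⊕ W} : (both D Dc).Sat a u ↔ origSat D Dc a u := by
  rcases u with u | u
  · exact Circuit.sat_map_iff (C := D.toCircuit) (ι := id) fun _ => rfl
  · exact Circuit.sat_map_iff (C := Dc.toCircuit) (ι := id) fun _ => rfl

/-- The decomposition nodes in the disjoint union of the circuits. -/
def IsDNodeY (D : NNF X V) (Dc : NNF X W) (T : VTree X) : V ⊕ W → VTree X → Prop :=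
  Sum.elim (D.IsDNode T) (Dc.IsDNode T)

theorem isDNodeY_of_mem_RY {p : X → Bool} {u : V ⊕ W} {v : VTree X}
    (h : u ∈ RY D Dc T p v) : IsDNodeY D Dc T u v := by
  rcases h with ⟨u, hu, rfl⟩ | ⟨u, hu, rfl⟩ <;> exact hu.2

/-! ### The partition formed by the two circuits together -/

namespace ComplementaryPair

theorem exists_isDNodeY (h : ComplementaryPair D Dc T) {u : V ⊕ W}
    (hu : ∀ b, (both D Dc).gate u ≠ .const b) : ∃ v, IsDNodeY D Dc T u v := by
  rcases u with u | u
  · refine h.left.exists_isDNode fun b hb => hu b ?_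
    change (D.gate u).map id Sum.inl = _
    rw [hb]; rfl
  · refine h.right.exists_isDNode fun b hb => hu b ?_
    change (Dc.gate u).map id Sum.inr = _
    rw [hb]; rfl

theorem dnodeY_eq (h : ComplementaryPair D Dc T) {u : V ⊕ W} {v : VTree X}
    (hu : IsDNodeY D Dc T u v) : dnodeY D Dc T u = v := by
  rcases u with u | u
  · exact h.left.dnode_eq hu
  · exact h.right.dnode_eq hu

theorem isDNodeY_dnodeY (h : ComplementaryPair D Dc T) {u : V ⊕ W}
    (hu : ∀ b, (both D Dc).gate u ≠ .const b) : IsDNodeY D Dc T u (dnodeY D Dc T u) := by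
  obtain ⟨v, hv⟩ := h.exists_isDNodeY hu
  rwa [h.dnodeY_eq hv]

theorem isDNodeY_subtree (h : ComplementaryPair D Dc T) {u : V ⊕ W} {v : VTree X}
    (hu : IsDNodeY D Dc T u v) : v.Subtree T := by
  rcases u with u | u
  · exact (h.left.isDNode_iff.1 hu).1
  · exact (h.right.isDNode_iff.1 hu).1

theorem dnodeY_subtree (h : ComplementaryPair D Dc T) (u : V ⊕ W) :
    (dnodeY D Dc T u).Subtree T := by
  by_cases hu : ∃ v, IsDNodeY D Dc T u v
  · obtain ⟨v, hv⟩ := hu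
    rw [h.dnodeY_eq hv]
    exact h.isDNodeY_subtree hv
  · rcases u with u | u
    · change (D.dnode T u).Subtree T
      unfold Circuit.dnode
      rw [dif_neg (show ¬ ∃ v, D.IsDNode T u v from hu)]
      exact .refl T
    · change (Dc.dnode T u).Subtree T
      unfold Circuit.dnode
      rw [dif_neg (show ¬ ∃ v, Dc.IsDNode T u v from hu)]
      exact .refl T

theorem isDNodeY_lit (h : ComplementaryPair D Dc T) {u : V ⊕ W} {x : X} {b : Bool}
    {v : VTree X} (hg : (both D Dc).gate u = .lit x b) (hu : IsDNodeY D Dc T u v) :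
    v = .leaf x := by
  rcases both_lit hg with ⟨u, rfl, hg'⟩ | ⟨u, rfl, hg'⟩
  · exact h.left.isDNode_lit hg' hu
  · exact h.right.isDNode_lit hg' hu

theorem isDNodeY_and (h : ComplementaryPair D Dc T) {u l r : V ⊕ W} {v : VTree X}
    (hg : (both D Dc).gate u = .and l r) (hu : IsDNodeY D Dc T u v) :
    ∃ vl vr, v = .node vl vr ∧ IsDNodeY D Dc T l vl ∧ IsDNodeY D Dc T r vr := by
  rcases both_and hg with ⟨u, l, r, rfl, rfl, rfl, hg'⟩ | ⟨u, l, r, rfl, rfl, rfl, hg'⟩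
  · exact h.left.isDNode_and hg' hu
  · exact h.right.isDNode_and hg' hu

theorem not_const_of_isDNodeY {u : V ⊕ W} {v : VTree X} (hu : IsDNodeY D Dc T u v) (b : Bool) :
    (both D Dc).gate u ≠ .const b := by
  intro hg
  rcases both_const hg with ⟨u, rfl, hg'⟩ | ⟨u, rfl, hg'⟩
  · exact NNF.Regular.not_const_of_isDNode hu b hg'
  · exact NNF.Regular.not_const_of_isDNode hu b hg'

theorem exists_sat (h : ComplementaryPair D Dc T) {u : V ⊕ W} {v : VTree X}
    (hu : IsDNodeY D Dc T u v) : ∃ a, origSat D Dc a u := by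
  rcases u with u | u
  · exact h.left.exists_sat (NNF.Regular.not_const_of_isDNode hu)
  · exact h.right.exists_sat (NNF.Regular.not_const_of_isDNode hu)

theorem origSat_congr (h : ComplementaryPair D Dc T) {u : V ⊕ W} {v : VTree X}
    (hu : IsDNodeY D Dc T u v) {a b : X → Bool} (hab : ∀ x ∈ v.vars, a x = b x) :
    origSat D Dc a u ↔ origSat D Dc b u := by
  rcases u with u | u
  · exact Circuit.sat_congr fun x hx => hab x ((h.left.isDNode_iff.1 hu).2 ▸ hx)
  · exact Circuit.sat_congr fun x hx => hab x ((h.right.isDNode_iff.1 hu).2 ▸ hx)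

theorem exists_mem_RY (h : ComplementaryPair D Dc T) {u : V ⊕ W} {v : VTree X}
    (hu : IsDNodeY D Dc T u v) : ∃ p, u ∈ RY D Dc T p v := by
  rcases u with u | u
  · obtain ⟨p, hp⟩ := h.left.exists_mem_R hu
    exact ⟨p, .inl ⟨u, hp, rfl⟩⟩
  · obtain ⟨p, hp⟩ := h.right.exists_mem_R hu
    exact ⟨p, .inr ⟨u, hp, rfl⟩⟩

theorem mem_RPlusY_iff (h : ComplementaryPair D Dc T) {u : V ⊕ W} {p : X → Bool}
    {v : VTree X} :
    u ∈ RPlusY D Dc T p v ↔ u ∈ RY D Dc T p v ∧ ∀ cs, (both D Dc).gate u ≠ .or cs := by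
  rcases u with u | u
  · simp [RPlusY, RY, both_or_iff_inl, h.left.mem_RPlus_iff]
  · simp [RPlusY, RY, both_or_iff_inr, h.right.mem_RPlus_iff]

theorem isDNodeY_of_mem_RPlusY (h : ComplementaryPair D Dc T) {u : V ⊕ W} {p : X → Bool}
    {v : VTree X} (hu : u ∈ RPlusY D Dc T p v) : IsDNodeY D Dc T u v :=
  isDNodeY_of_mem_RY (h.mem_RPlusY_iff.1 hu).1

/-- Simplicity enters here: with no edges between ∨-gates, the children of a disjunction in `R` fall
into `R⁺`. -/
theorem mem_RPlusY_of_or (h : ComplementaryPair D Dc T) {u c : V ⊕ W} {cs : Set (V ⊕ W)}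
    {p : X → Bool} {v : VTree X} (hg : (both D Dc).gate u = .or cs) (hc : c ∈ cs)
    (hu : u ∈ RY D Dc T p v) : c ∈ RPlusY D Dc T p v := by
  rw [h.mem_RPlusY_iff]
  rcases both_or hg with ⟨u, cs, rfl, rfl, hg'⟩ | ⟨u, cs, rfl, rfl, hg'⟩
  · obtain ⟨c, hc, rfl⟩ := hc
    rw [both_or_iff_inl]
    obtain ⟨_, hu, e⟩ | ⟨_, _, e⟩ := hu <;> cases e
    exact ⟨.inl ⟨c, h.left.mem_R_of_or hg' hc hu, rfl⟩, h.left.simple.no_or_or u cs hg' c hc⟩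
  · obtain ⟨c, hc, rfl⟩ := hc
    rw [both_or_iff_inr]
    obtain ⟨_, _, e⟩ | ⟨_, hu, e⟩ := hu <;> cases e
    exact ⟨.inr ⟨c, h.right.mem_R_of_or hg' hc hu, rfl⟩, h.right.simple.no_or_or u cs hg' c hc⟩

theorem not_isDNodeY_of_and_child (h : ComplementaryPair D Dc T) {u l r w : V ⊕ W}
    {v : VTree X} (hg : (both D Dc).gate u = .and l r) (hw : w = l ∨ w = r)
    (hu : IsDNodeY D Dc T u v) : ¬ IsDNodeY D Dc T w v := by
  rcases both_and hg with ⟨u, l, r, rfl, rfl, rfl, hg'⟩ | ⟨u, l, r, rfl, rfl, rfl, hg'⟩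
  · rcases hw with rfl | rfl
    · exact fun hw => h.left.not_vars_subset_of_and_child hg' (.inl rfl)
        ((h.left.isDNode_iff.1 hu).2.trans (h.left.isDNode_iff.1 hw).2.symm).le
    · exact fun hw => h.left.not_vars_subset_of_and_child hg' (.inr rfl)
        ((h.left.isDNode_iff.1 hu).2.trans (h.left.isDNode_iff.1 hw).2.symm).le
  · rcases hw with rfl | rfl
    · exact fun hw => h.right.not_vars_subset_of_and_child hg' (.inl rfl)
        ((h.right.isDNode_iff.1 hu).2.trans (h.right.isDNode_iff.1 hw).2.symm).le
    · exact fun hw => h.right.not_vars_subset_of_and_child hg' (.inr rfl)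
        ((h.right.isDNode_iff.1 hu).2.trans (h.right.isDNode_iff.1 hw).2.symm).le

/-- A satisfied root is not a constant if one of the circuits has a node that is not a
constant. -/
theorem roots_not_const (h : ComplementaryPair D Dc T) {u : V ⊕ W} {v : VTree X}
    (hu : IsDNodeY D Dc T u v) (a : X → Bool) :
    (D.Sat a D.root → ∀ b, D.gate D.root ≠ .const b) ∧
      (Dc.Sat a Dc.root → ∀ b, Dc.gate Dc.root ≠ .const b) := by
  rcases u with u | u
  · have hr := h.left.root_not_const (NNF.Regular.not_const_of_isDNode hu)
    refine ⟨fun _ => hr, fun hs b hb => ?_⟩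
    obtain rfl := (Circuit.sat_const hb).1 hs
    -- A complement root labeled ⊤ would make the other root unsatisfiable, hence a constant.
    refine hr false (h.left.simple.bot_only _ fun a ha => ?_)
    exact (h.root_iff a).1 ha (.const hb)
  · have hr := h.right.root_not_const (NNF.Regular.not_const_of_isDNode hu)
    refine ⟨fun hs b hb => ?_, fun _ => hr⟩
    obtain rfl := (Circuit.sat_const hb).1 hs
    refine hr false (h.right.simple.bot_only _ fun a ha => ?_)
    exact (h.root_iff a).1 (.const hb) ha

open Classical in
/-- The assignment `a` below `v`, and `p` elsewhere. -/
theorem exists_glue (v : VTree X) (a p : X → Bool) :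
    ∃ e : X → Bool, (∀ x ∈ v.vars, a x = e x) ∧ ∀ x ∈ v.shell, e x = p x :=
  ⟨fun x => if x ∈ v.vars then a x else p x, fun _ hx => (if_pos hx).symm,
    fun _ hx => if_neg hx⟩

/-- The functions in `R⁺(D_p, v) ∪ R⁺(Dc_p, v)` cover all assignments. -/
theorem RPlusY_cover (h : ComplementaryPair D Dc T) {u : V ⊕ W} {v : VTree X}
    (hu : IsDNodeY D Dc T u v) (p a : X → Bool) :
    ∃ w ∈ RPlusY D Dc T p v, origSat D Dc a w := by
  obtain ⟨e, hae, hep⟩ := exists_glue v a p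
  have hr := h.roots_not_const hu e
  have hv := h.isDNodeY_subtree hu
  -- The functions in question depend only on `vars(v)`, so `a` may be replaced by `e`, which agrees
  -- with `p` on the shell.
  suffices ∃ w ∈ RPlusY D Dc T p v, origSat D Dc e w by
    obtain ⟨w, hw, hs⟩ := this
    exact ⟨w, hw, (h.origSat_congr (h.isDNodeY_of_mem_RPlusY hw) hae).2 hs⟩
  by_cases hs : Dc.Sat e Dc.root
  · obtain ⟨w, hw, hs'⟩ := h.right.exists_mem_RPlus hv hep hs (hr.2 hs)
    exact ⟨.inr w, .inr ⟨w, hw, rfl⟩, hs'⟩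
  · have hs := (h.root_iff e).2 hs
    obtain ⟨w, hw, hs'⟩ := h.left.exists_mem_RPlus hv hep hs (hr.1 hs)
    exact ⟨.inl w, .inl ⟨w, hw, rfl⟩, hs'⟩

/-- The functions in `R⁺(D_p, v) ∪ R⁺(Dc_p, v)` are pairwise disjoint. -/
theorem RPlusY_disjoint (h : ComplementaryPair D Dc T) {m n : V ⊕ W} {v : VTree X}
    {a p : X → Bool} (hm : m ∈ RPlusY D Dc T p v) (hn : n ∈ RPlusY D Dc T p v)
    (hsm : origSat D Dc a m) (hsn : origSat D Dc a n) : m = n := by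
  obtain ⟨e, hae, hep⟩ := exists_glue v a p
  rw [h.origSat_congr (h.isDNodeY_of_mem_RPlusY hm) hae] at hsm
  rw [h.origSat_congr (h.isDNodeY_of_mem_RPlusY hn) hae] at hsn
  rcases hm with ⟨m, hm, rfl⟩ | ⟨m, hm, rfl⟩ <;> rcases hn with ⟨n, hn, rfl⟩ | ⟨n, hn, rfl⟩
  · rw [h.left.RPlus_disjoint hm hn hep hsm hsn]
  -- Gates from different circuits would make both roots true at `e`.
  · exact absurd (h.right.satPath_of_mem_R hn.1 hep hsn).1
      ((h.root_iff e).1 (h.left.satPath_of_mem_R hm.1 hep hsm).1)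
  · exact absurd (h.right.satPath_of_mem_R hm.1 hep hsm).1
      ((h.root_iff e).1 (h.left.satPath_of_mem_R hn.1 hep hsn).1)
  · rw [h.right.RPlus_disjoint hm hn hep hsm hsn]

/-- The function at a node depends only on the variables of its decomposition node. -/
theorem origSat_congr_dnodeY (h : ComplementaryPair D Dc T) {u : V ⊕ W} {a b : X → Bool}
    (hab : ∀ x ∈ (dnodeY D Dc T u).vars, a x = b x) :
    origSat D Dc a u ↔ origSat D Dc b u := by
  by_cases hu : ∃ c, (both D Dc).gate u = .const c
  · obtain ⟨c, hc⟩ := hu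
    rw [← sat_both, ← sat_both, Circuit.sat_const hc, Circuit.sat_const hc]
  · exact h.origSat_congr (h.isDNodeY_dnodeY (not_exists.1 hu)) hab

end ComplementaryPair

end Pair

/-! ## SDDs on at most two variables -/

/-- A function of one variable is a constant or a literal. The label is chosen before the circuit,
so that it can be used while one is being built. -/
theorem exists_gate_leaf {X N : Type*} (x : X) (g : Bool → Prop) :
    ∃ G : Gate X N, ∀ (C : Circuit X N) (u : N), C.gate u = G →
      C.IsSDD (.leaf x) u ∧ ∀ a, C.Sat a u ↔ g (a x) := by
  have hx : x ∈ (VTree.leaf x).vars := by simp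
  by_cases h1 : g true <;> by_cases h0 : g false
  · refine ⟨.const true, fun C u hG => ⟨.const hG, fun a => ?_⟩⟩
    rw [Circuit.sat_const hG]; cases a x <;> simp [h1, h0]
  · refine ⟨.lit x true, fun C u hG => ⟨.lit hG hx, fun a => ?_⟩⟩
    rw [Circuit.sat_lit hG]; cases a x <;> simp [h1, h0]
  · refine ⟨.lit x false, fun C u hG => ⟨.lit hG hx, fun a => ?_⟩⟩
    rw [Circuit.sat_lit hG]; cases a x <;> simp [h1, h0]
  · refine ⟨.const false, fun C u hG => ⟨.const hG, fun a => ?_⟩⟩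
    rw [Circuit.sat_const hG]; cases a x <;> simp [h1, h0]

theorem VTree.exists_of_card_le_two {X : Type*} {v : VTree X} (h : v.card ≤ 2) :
    (∃ x, v = leaf x) ∨ ∃ x y, v = node (leaf x) (leaf y) := by
  rcases v with x | ⟨l, r⟩
  · exact .inl ⟨x, rfl⟩
  · rw [card_node] at h
    have hl := l.card_pos
    have hr := r.card_pos
    rcases l with x | ⟨l1, l2⟩
    · rcases r with y | ⟨r1, r2⟩
      · exact .inr ⟨x, y, rfl⟩
      · have := r1.card_pos; have := r2.card_pos
        rw [card_node] at h; omega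
    · have := l1.card_pos; have := l2.card_pos
      rw [card_node] at h; omega

open Classical in
/-- Every function on at most two variables has an SDD with at most seven nodes. -/
theorem exists_small_sdd {X : Type*} {v : VTree X} (hv : v.card ≤ 2) (g : (X → Bool) → Prop)
    (hg : ∀ a b, (∀ x ∈ v.vars, a x = b x) → (g a ↔ g b)) :
    ∃ C : Circuit X (Option (Bool × Option Bool)), C.IsSDD v none ∧ ∀ a, C.Sat a none ↔ g a := by
  rcases VTree.exists_of_card_le_two hv with ⟨x, rfl⟩ | ⟨x, y, rfl⟩
  · obtain ⟨G, hG⟩ := exists_gate_leaf (N := Option (Bool × Option Bool)) x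
      fun c => g fun _ => c
    refine ⟨⟨fun _ => G⟩, (hG _ _ rfl).1, fun a => ((hG _ _ rfl).2 a).trans (hg _ _ ?_)⟩
    simp
  · choose G hG using fun b => exists_gate_leaf (N := Option (Bool × Option Bool)) y
      fun c => g fun z => if z = x then b else c
    -- Shannon expansion on `x`: the primes are the two literals of `x`, the subs the corresponding
    -- cofactors in `y`.
    let C : Circuit X (Option (Bool × Option Bool)) :=
      ⟨fun
        | none => .or (Set.range fun b => some (b, none))
        | some (b, none) => .and (some (b, some true)) (some (b, some false))
        | some (b, some true) => .lit x b
        | some (b, some false) => G b⟩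
    have hor : C.gate none = .or (Set.range fun b => some (b, none)) := rfl
    have hand (b : Bool) :
        C.gate (some (b, none)) = .and (some (b, some true)) (some (b, some false)) := rfl
    have hlit (b : Bool) : C.gate (some (b, some true)) = .lit x b := rfl
    have hsub (b : Bool) := hG b C (some (b, some false)) rfl
    refine ⟨C, .of_decomposition hor (.refl _) ?_ ?_ ?_, fun a => ?_⟩
    · rintro _ ⟨b, rfl⟩
      exact ⟨_, _, hand b, .lit (hlit b) (by simp), (hsub b).1, fun _ => b,
        (Circuit.sat_lit (hlit b)).2 rfl⟩
    · rintro _ ⟨b, rfl⟩ _ ⟨c, rfl⟩ l r l' r' a hb hc hl hl'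
      rw [hand] at hb hc
      cases hb; cases hc
      rw [Circuit.sat_lit (hlit _)] at hl hl'
      rw [← hl, ← hl']
    · exact fun a => ⟨_, ⟨a x, rfl⟩, _, _, hand _, (Circuit.sat_lit (hlit _)).2 rfl⟩
    · rw [Circuit.sat_or hor, Set.exists_range_iff]
      simp only [Circuit.sat_and (hand _), Circuit.sat_lit (hlit _), (hsub _).2]
      rw [exists_eq_left']
      refine hg _ _ fun z hz => ?_
      rw [VTree.vars_node, VTree.vars_leaf, VTree.vars_leaf] at hz
      rcases hz with rfl | rfl
      · simp
      · split_ifs with h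
        · rw [h]
        · rfl

/-! ## The choices are possible -/

section Simulation

variable {X V W : Type*} {D : NNF X V} {Dc : NNF X W} {T : VTree X}

theorem ComplementaryPair.nonempty_simulationData [Finite V] [Finite W]
    (h : ComplementaryPair D Dc T) : Nonempty (SimulationData D Dc T) := by
  have hR : ∀ w : V ⊕ W, (∀ b, (both D Dc).gate w ≠ .const b) →
      ∃ p, w ∈ RY D Dc T p (dnodeY D Dc T w) :=
    fun w hw => h.exists_mem_RY (h.isDNodeY_dnodeY hw)
  have hp : ∀ u : V ⊕ W, ∃ p,
      (∀ cs, (both D Dc).gate u = .or cs → u ∈ RY D Dc T p (dnodeY D Dc T u)) ∧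
      ∀ l r, (both D Dc).gate u = .and l r → l ∈ RY D Dc T p (dnodeY D Dc T l) := by
    intro u
    rcases hg : (both D Dc).gate u with b | ⟨x, b⟩ | ⟨l, r⟩ | cs
    · exact ⟨fun _ => false, by simp, by simp⟩
    · exact ⟨fun _ => false, by simp, by simp⟩
    · obtain ⟨v, hv⟩ := h.exists_isDNodeY (u := u) (by simp [hg])
      obtain ⟨_, _, _, hl, _⟩ := h.isDNodeY_and hg hv
      obtain ⟨p, hp⟩ := hR l (ComplementaryPair.not_const_of_isDNodeY hl)
      refine ⟨p, by simp, fun l' r' e => ?_⟩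
      cases e; exact hp
    · obtain ⟨p, hp⟩ := hR u (by simp [hg])
      exact ⟨p, fun _ _ => hp, by simp⟩
  choose p hpor hpand using hp
  have hB : ∀ u : V ⊕ W, ∃ C : Circuit X (Option (Bool × Option Bool)),
      (dnodeY D Dc T u).card ≤ 2 →
        C.IsSDD (dnodeY D Dc T u) none ∧ ∀ a, C.Sat a none ↔ origSat D Dc a u := by
    intro u
    by_cases hc : (dnodeY D Dc T u).card ≤ 2
    · obtain ⟨C, hC⟩ := exists_small_sdd hc (fun a => origSat D Dc a u)
        fun a b hab => h.origSat_congr_dnodeY hab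
      exact ⟨C, fun _ => hC⟩
    · exact ⟨⟨fun _ => .const true⟩, fun hc' => absurd hc' hc⟩
  choose C hC using hB
  -- The blocks are joined into one circuit. Indexing by `Fin n` keeps its node type in `Type`,
  -- whatever the universes of `V` and `W`.
  obtain ⟨n, ⟨e⟩⟩ := Finite.exists_equiv_fin (V ⊕ W)
  let B : Circuit X (Fin n × Option (Bool × Option Bool)) :=
    ⟨fun q => ((C (e.symm q.1)).gate q.2).map id (Prod.mk q.1)⟩
  have hB (u : V ⊕ W) (m) : B.gate (e u, m) = ((C u).gate m).map id (Prod.mk (e u)) := by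
    simp [B]
  exact ⟨{
    p := p
    p_or := fun u cs hg _ => hpor u cs hg
    p_and := fun u l r hg _ => hpand u l r hg
    BlockNode := Fin n × Option (Bool × Option Bool)
    finite_block := inferInstance
    block := B
    blockRoot := fun u => (e u, none)
    block_sdd := fun u hu => by
      have := (hC u hu).1.map Function.injective_id (hB u)
      rwa [VTree.map_id] at this
    block_fun := fun u hu a =>
      (Circuit.sat_map_iff (ι := id) (hB u)).trans ((hC u hu).2 a) }⟩

/-! ## Correctness of the simulation -/

theorem nodeTree_subtree_modified (u : V ⊕ W) :
    (nodeTree D Dc T u).Subtree (dnodeY D Dc T u).modified := by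
  unfold nodeTree
  split_ifs
  · exact VTree.oldNode_subtree_modified _
  · exact .refl _

theorem nodeTree_eq_oldNode {u : V ⊕ W}
    (h : (∃ l r, (both D Dc).gate u = .and l r) ∨ (dnodeY D Dc T u).card ≤ 2) :
    nodeTree D Dc T u = (dnodeY D Dc T u).oldNode :=
  if_pos h

/-- The subcircuit of the constructed graph at `(u, ∅)` is an SDD for the function at `u`. -/
def Correct (s : SimulationData D Dc T) (u : V ⊕ W) : Prop :=
  (simulationGraph s).IsSDD (nodeTree D Dc T u) (.main u) ∧
    ∀ a, (simulationGraph s).Sat a (.main u) ↔ origSat D Dc (a ∘ Sum.inl) u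

variable (s : SimulationData D Dc T)

theorem Correct.isSDD_modified {s : SimulationData D Dc T} {u : V ⊕ W} (h : Correct s u) :
    (simulationGraph s).IsSDD (dnodeY D Dc T u).modified (.main u) :=
  h.1.mono (nodeTree_subtree_modified u)

theorem correct_const {u : V ⊕ W} {b : Bool} (hg : (both D Dc).gate u = .const b) :
    Correct s u := by
  have hm : (simulationGraph s).gate (.main u) = .const b := by
    simp only [simulationGraph, hg]
  exact ⟨.const hm, fun a => by
    rw [← sat_both, Circuit.sat_const hm, Circuit.sat_const hg]⟩

theorem correct_lit (h : ComplementaryPair D Dc T) {u : V ⊕ W} {x : X} {b : Bool}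
    (hg : (both D Dc).gate u = .lit x b) : Correct s u := by
  have hm : (simulationGraph s).gate (.main u) = .lit (Sum.inl x) b := by
    simp only [simulationGraph, hg]
  have hd := h.isDNodeY_lit hg (h.isDNodeY_dnodeY (by simp [hg]))
  refine ⟨.lit hm ?_, fun a => ?_⟩
  · rw [nodeTree_eq_oldNode (.inr (by simp [hd, VTree.card, VTree.leaves])), hd]
    simp [VTree.oldNode]
  · rw [← sat_both, Circuit.sat_lit hm, Circuit.sat_lit hg, Function.comp_apply]

theorem correct_of_card_le (h : ComplementaryPair D Dc T) {u : V ⊕ W}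
    (hu : (dnodeY D Dc T u).card ≤ 2) : Correct s u := by
  rcases hg : (both D Dc).gate u with b | ⟨x, b⟩ | ⟨l, r⟩ | cs
  · exact correct_const s hg
  · exact correct_lit s h hg
  all_goals
    have hm : (simulationGraph s).gate (.block (s.blockRoot u)) =
        (simulationGraph s).gate (.main u) := by
      simp only [simulationGraph, hg, if_pos hu]
    have hB : ∀ n, (simulationGraph s).gate (.block n) = (s.block.gate n).map Sum.inl .block :=
      fun _ => rfl
    refine ⟨?_, fun a => ?_⟩
    · rw [nodeTree_eq_oldNode (.inr hu), ← VTree.modified_of_card_le hu,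
        VTree.modified_eq_map hu]
      exact ((s.block_sdd u hu).map Sum.inl_injective hB).of_gate_eq hm
    · rw [← s.block_fun u hu, ← Circuit.sat_map_iff hB]
      exact ⟨Circuit.sat_of_gate_eq hm.symm, Circuit.sat_of_gate_eq hm⟩

/-- The function at `l` is either an element of the partition at `vl` or, if `l` is a disjunction,
the union of those elements that are its children. Replacing these by `l` gives a partition again,
and only the gate `(u, ∧)` contributes to the value. -/
theorem correct_and (h : ComplementaryPair D Dc T) {u l r : V ⊕ W} {vl vr : VTree X}
    (hg : (both D Dc).gate u = .and l r) (hu : IsDNodeY D Dc T u (.node vl vr))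
    (hc : 2 < (VTree.node vl vr).card) (ihl : ∀ w, IsDNodeY D Dc T w vl → Correct s w)
    (ihr : ∀ w, IsDNodeY D Dc T w vr → Correct s w) : Correct s u := by
  have hd := h.dnodeY_eq hu
  obtain ⟨_, _, e, hl, hr⟩ := h.isDNodeY_and hg hu
  cases e
  have hdl := h.dnodeY_eq hl
  have hlR : l ∈ RY D Dc T (s.p u) vl := hdl ▸ s.p_and u l r hg (hd ▸ hc)
  have hm : (simulationGraph s).gate (.main u) = .or (insert (.wedge u)
      (.pair u '' {w | w ∈ RPlusY D Dc T (s.p u) vl ∧ w ≠ l ∧ ¬ (both D Dc).Child l w})) := by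
    simp only [simulationGraph, hg, hd, hdl, if_neg (not_le.2 hc)]
  have hwedge : (simulationGraph s).gate (.wedge u) = .and (.main l) (.main r) := by
    simp only [simulationGraph, hg]
  have hpair (w : V ⊕ W) :
      (simulationGraph s).gate (.pair u w) = .and (.main w) (.bot u) := by
    simp only [simulationGraph, hg]
  have hbot : (simulationGraph s).gate (.bot u) = .const false := rfl
  have hsat (v : VTree X) (ih : ∀ w, IsDNodeY D Dc T w v → Correct s w) (w : V ⊕ W)
      (hw : IsDNodeY D Dc T w v) : ∃ a, (simulationGraph s).Sat a (.main w) := by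
    obtain ⟨a, ha⟩ := h.exists_sat hw
    exact ⟨Sum.elim a fun _ => false, ((ih w hw).2 _).2 (by rwa [Sum.elim_comp_inl])⟩
  have hSDD (v : VTree X) (ih : ∀ w, IsDNodeY D Dc T w v → Correct s w) (w : V ⊕ W)
      (hw : IsDNodeY D Dc T w v) : (simulationGraph s).IsSDD v.modified (.main w) := by
    have := (ih w hw).isSDD_modified
    rwa [h.dnodeY_eq hw] at this
  -- If `l` is a disjunction, one of its children is true and lies in `R⁺`; otherwise `l` itself
  -- lies in `R⁺`.
  have hdisj : ∀ w ∈ RPlusY D Dc T (s.p u) vl, w ≠ l → ¬ (both D Dc).Child l w → ∀ a,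
      origSat D Dc a l → ¬ origSat D Dc a w := by
    intro w hw hwl hwc a hsl hsw
    by_cases hor : ∃ cs, (both D Dc).gate l = .or cs
    · obtain ⟨cs, hcs⟩ := hor
      obtain ⟨c, hcc, hsc⟩ := (Circuit.sat_or hcs).1 (sat_both.2 hsl)
      obtain rfl := h.RPlusY_disjoint (h.mem_RPlusY_of_or hcs hcc hlR) hw (sat_both.1 hsc) hsw
      exact hwc (Circuit.child_of_or hcs hcc)
    · exact hwl (h.RPlusY_disjoint hw (h.mem_RPlusY_iff.2 ⟨hlR, not_exists.1 hor⟩) hsw hsl)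
  refine ⟨?_, fun a => ?_⟩
  · rw [nodeTree_eq_oldNode (.inl ⟨l, r, hg⟩), hd, VTree.oldNode]
    refine .of_decomposition hm (.refl _) ?_ ?_ ?_
    · rintro _ (rfl | ⟨w, ⟨hw, -, -⟩, rfl⟩)
      · exact ⟨_, _, hwedge, hSDD vl ihl l hl, hSDD vr ihr r hr, hsat vl ihl l hl⟩
      · have hdw := h.isDNodeY_of_mem_RPlusY hw
        exact ⟨_, _, hpair w, hSDD vl ihl w hdw, .const hbot, hsat vl ihl w hdw⟩
    · rintro _ (rfl | ⟨w, ⟨hw, hwl, hwc⟩, rfl⟩) _ (rfl | ⟨w', ⟨hw', hwl', hwc'⟩, rfl⟩)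
        l₁ r₁ l₂ r₂ a h₁ h₂ hs₁ hs₂
      · rfl
      · rw [hwedge] at h₁; rw [hpair] at h₂; cases h₁; cases h₂
        rw [(ihl _ hl).2] at hs₁
        rw [(ihl _ (h.isDNodeY_of_mem_RPlusY hw')).2] at hs₂
        exact absurd hs₂ (hdisj w' hw' hwl' hwc' _ hs₁)
      · rw [hwedge] at h₂; rw [hpair] at h₁; cases h₁; cases h₂
        rw [(ihl _ hl).2] at hs₂
        rw [(ihl _ (h.isDNodeY_of_mem_RPlusY hw)).2] at hs₁
        exact absurd hs₁ (hdisj w hw hwl hwc _ hs₂)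
      · rw [hpair] at h₁ h₂; cases h₁; cases h₂
        rw [(ihl _ (h.isDNodeY_of_mem_RPlusY hw)).2] at hs₁
        rw [(ihl _ (h.isDNodeY_of_mem_RPlusY hw')).2] at hs₂
        rw [h.RPlusY_disjoint hw hw' hs₁ hs₂]
    · intro a
      by_cases hsl : origSat D Dc (a ∘ Sum.inl) l
      · exact ⟨_, .inl rfl, _, _, hwedge, ((ihl l hl).2 a).2 hsl⟩
      -- When `l` is false, the true element `w` is none of those removed: it is not `l`, nor a
      -- child of a disjunction `l`, and children of a conjunction `l` lie at lower vtree nodes.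
      obtain ⟨w, hw, hs⟩ := h.RPlusY_cover hl (s.p u) (a ∘ Sum.inl)
      refine ⟨_, .inr ⟨w, ⟨hw, ?_, fun hc => ?_⟩, rfl⟩, _, _, hpair w,
        ((ihl w (h.isDNodeY_of_mem_RPlusY hw)).2 a).2 hs⟩
      · rintro rfl; exact hsl hs
      · rcases Circuit.child_cases hc with ⟨l', r', hg', hw'⟩ | ⟨cs, hg', hw'⟩
        · exact h.not_isDNodeY_of_and_child hg' hw' hl (h.isDNodeY_of_mem_RPlusY hw)
        · exact hsl (sat_both.1 (.or hg' hw' (sat_both.2 hs)))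
  · rw [Circuit.sat_or hm, ← sat_both, Circuit.sat_and hg, sat_both, sat_both,
      ← (ihl l hl).2, ← (ihr r hr).2, ← Circuit.sat_and hwedge]
    refine ⟨?_, fun hs => ⟨_, .inl rfl, hs⟩⟩
    rintro ⟨_, rfl | ⟨w, -, rfl⟩, hs⟩
    · exact hs
    · rw [Circuit.sat_and (hpair w), Circuit.sat_const hbot] at hs
      exact absurd hs.2 (by simp)

/-- All children of `u` belong to the partition at `v`, so keeping exactly those primes yields the
function at `u`. Only conjunctions at the same node `v` are needed inductively. -/
theorem correct_or (h : ComplementaryPair D Dc T) {u : V ⊕ W} {cs : Set (V ⊕ W)}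
    {v : VTree X} (hg : (both D Dc).gate u = .or cs) (hu : IsDNodeY D Dc T u v)
    (hc : 2 < v.card)
    (ih : ∀ w, IsDNodeY D Dc T w v → (∃ l r, (both D Dc).gate w = .and l r) → Correct s w) :
    Correct s u := by
  have hd := h.dnodeY_eq hu
  have huR : u ∈ RY D Dc T (s.p u) v := hd ▸ s.p_or u cs hg (hd ▸ hc)
  have hm : (simulationGraph s).gate (.main u) =
      .or (.pair u '' RPlusY D Dc T (s.p u) v) := by
    simp only [simulationGraph, hg, hd, if_neg (not_le.2 hc)]
  have hpair_pos (w : V ⊕ W) (hw : w ∈ cs) :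
      (simulationGraph s).gate (.pair u w) = .and (.main w) (.top u) := by
    simp only [simulationGraph, hg, if_pos hw]
  have hpair_neg (w : V ⊕ W) (hw : w ∉ cs) :
      (simulationGraph s).gate (.pair u w) = .and (.main w) (.bot u) := by
    simp only [simulationGraph, hg, if_neg hw]
  have htop : (simulationGraph s).gate (.top u) = .const true := rfl
  have hbot : (simulationGraph s).gate (.bot u) = .const false := rfl
  have hpair (w : V ⊕ W) :
      ∃ n b, (simulationGraph s).gate (.pair u w) = .and (.main w) n ∧
        (simulationGraph s).gate n = .const b := by
    by_cases hw : w ∈ cs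
    · exact ⟨_, _, hpair_pos w hw, htop⟩
    · exact ⟨_, _, hpair_neg w hw, hbot⟩
  -- More than two variables exclude literals. Conjunctions are placed at the old node `v`, which is
  -- the left child of the new parent, as a prime requires.
  have hand : ∀ w ∈ RPlusY D Dc T (s.p u) v, ∃ l r, (both D Dc).gate w = .and l r := by
    intro w hw
    have hdw := h.isDNodeY_of_mem_RPlusY hw
    rcases hgw : (both D Dc).gate w with b | ⟨x, b⟩ | ⟨l, r⟩ | cs
    · exact absurd hgw (ComplementaryPair.not_const_of_isDNodeY hdw b)
    · rw [h.isDNodeY_lit hgw hdw] at hc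
      simp [VTree.card, VTree.leaves] at hc
    · exact ⟨l, r, rfl⟩
    · exact absurd hgw ((h.mem_RPlusY_iff.1 hw).2 cs)
  have ih' : ∀ w ∈ RPlusY D Dc T (s.p u) v, Correct s w :=
    fun w hw => ih w (h.isDNodeY_of_mem_RPlusY hw) (hand w hw)
  refine ⟨?_, fun a => ?_⟩
  · have hnt : nodeTree D Dc T u = .node v.oldNode (.leaf (Sum.inr v)) := by
      rw [nodeTree, hd, if_neg (by simp [hg, hc]), VTree.modified_of_two_lt hc]
    rw [hnt]
    refine .of_decomposition hm (.refl _) ?_ ?_ ?_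
    · rintro _ ⟨w, hw, rfl⟩
      obtain ⟨n, b, hp, hn⟩ := hpair w
      have hdw := h.isDNodeY_of_mem_RPlusY hw
      refine ⟨_, _, hp, ?_, .const hn, ?_⟩
      · have := (ih' w hw).1
        rwa [nodeTree_eq_oldNode (.inl (hand w hw)), h.dnodeY_eq hdw] at this
      · obtain ⟨a, ha⟩ := h.exists_sat hdw
        exact ⟨Sum.elim a fun _ => false, ((ih' w hw).2 _).2 (by rwa [Sum.elim_comp_inl])⟩
    · rintro _ ⟨w, hw, rfl⟩ _ ⟨w', hw', rfl⟩ l₁ r₁ l₂ r₂ a h₁ h₂ hs₁ hs₂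
      obtain ⟨n, b, hp, -⟩ := hpair w
      obtain ⟨n', b', hp', -⟩ := hpair w'
      rw [hp] at h₁; rw [hp'] at h₂; cases h₁; cases h₂
      rw [(ih' w hw).2] at hs₁
      rw [(ih' w' hw').2] at hs₂
      rw [h.RPlusY_disjoint hw hw' hs₁ hs₂]
    · intro a
      obtain ⟨w, hw, hs⟩ := h.RPlusY_cover hu (s.p u) (a ∘ Sum.inl)
      obtain ⟨n, b, hp, -⟩ := hpair w
      exact ⟨_, ⟨w, hw, rfl⟩, _, _, hp, ((ih' w hw).2 a).2 hs⟩
  · rw [Circuit.sat_or hm, ← sat_both, Circuit.sat_or hg]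
    constructor
    · rintro ⟨_, ⟨w, hw, rfl⟩, hs⟩
      by_cases hwc : w ∈ cs
      · rw [Circuit.sat_and (hpair_pos w hwc), (ih' w hw).2] at hs
        exact ⟨w, hwc, sat_both.2 hs.1⟩
      · rw [Circuit.sat_and (hpair_neg w hwc), Circuit.sat_const hbot] at hs
        exact absurd hs.2 (by simp)
    · rintro ⟨w, hwc, hs⟩
      have hw := h.mem_RPlusY_of_or hg hwc huR
      exact ⟨_, ⟨w, hw, rfl⟩, .and (hpair_pos w hwc) (((ih' w hw).2 a).2 (sat_both.1 hs))
        (.const htop)⟩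

/-- The induction runs over the vtree, not the circuits, since primes may be gates of either circuit
that are not below `u`. -/
theorem correct_of_isDNodeY (h : ComplementaryPair D Dc T) {v : VTree X} :
    ∀ u, IsDNodeY D Dc T u v → Correct s u := by
  induction v with
  | leaf x =>
    intro u hu
    refine correct_of_card_le s h ?_
    rw [h.dnodeY_eq hu]; simp [VTree.card, VTree.leaves]
  | node vl vr ihl ihr =>
    intro u hu
    by_cases hc : (VTree.node vl vr).card ≤ 2
    · exact correct_of_card_le s h (by rwa [h.dnodeY_eq hu])
    · have hc := not_le.1 hc
      have hand : ∀ w, IsDNodeY D Dc T w (.node vl vr) →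
          (∃ l r, (both D Dc).gate w = .and l r) → Correct s w :=
        fun w hw ⟨l, r, hg⟩ => correct_and s h hg hw hc ihl ihr
      rcases hg : (both D Dc).gate u with b | ⟨x, b⟩ | ⟨l, r⟩ | cs
      · exact correct_const s hg
      · exact correct_lit s h hg
      · exact hand u hu ⟨l, r, hg⟩
      · exact correct_or s h hg hu hc hand

theorem correct (h : ComplementaryPair D Dc T) (u : V ⊕ W) : Correct s u := by
  by_cases hu : ∃ b, (both D Dc).gate u = .const b
  · obtain ⟨b, hb⟩ := hu
    exact correct_const s hb
  · exact correct_of_isDNodeY s h u (h.isDNodeY_dnodeY (not_exists.1 hu))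

end Simulation

end SDDSim

/-! ### The theorem, for the trimmed circuit -/

theorem mainTheorem2 {X V W : Type*} [Finite V] [Finite W]
    (T : VTree X) (hT : T.IsVTreeFor Set.univ) (hTn : T.Normalized)
    (D : NNF X V) (Dc : NNF X W)
    (hD : D.IsStructuredDDNNF T) (hDc : Dc.IsStructuredDDNNF T)
    (hDsmooth : D.Smooth) (hDcsmooth : Dc.Smooth)
    (hDsimple : D.Simple) (hDcsimple : Dc.Simple)
    (hDproper : D.Proper) (hDcproper : Dc.Proper)
    (f : (X → Bool) → Bool)
    (hf : D.Represents f) (hfc : Dc.Represents fun a => !f a) :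
    Nonempty (SimulationData D Dc T) ∧
    ∀ s : SimulationData D Dc T,
      (∀ (u : V ⊕ W)
        (hu : (simulationGraph s).Reach (simulationGraph s).root (SimNode.main u)),
        (nodeTree D Dc T u).Subtree T.modified ∧
        (simulation s).IsSDD (nodeTree D Dc T u) ⟨SimNode.main u, hu⟩ ∧
        ∀ a : X ⊕ VTree X → Bool,
          (simulation s).Sat a ⟨SimNode.main u, hu⟩ ↔
            origSat D Dc (fun x => a (Sum.inl x)) u) ∧
      T.modified.IsVTreeFor
        (Set.range Sum.inl ∪ Sum.inr '' {v : VTree X | v.Subtree T ∧ 2 < v.card}) ∧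
      (simulation s).IsSDD T.modified (simulation s).root ∧
      (simulation s).Represents fun a => f fun x => a (Sum.inl x) := by
  have hpair : ComplementaryPair D Dc T :=
    { left := ⟨hT.1, hT.2, hD, hDsmooth, hDsimple, hDproper⟩
      right := ⟨hT.1, hT.2, hDc, hDcsmooth, hDcsimple, hDcproper⟩
      root_iff := fun a => by rw [hf a, hfc a]; simp }
  refine ⟨hpair.nonempty_simulationData, fun s => ?_⟩
  have hsat (u : V ⊕ W)
      (hu : (simulationGraph s).Reach (simulationGraph s).root (SimNode.main u))
      (a : X ⊕ VTree X → Bool) : (simulation s).Sat a ⟨SimNode.main u, hu⟩ ↔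
        origSat D Dc (fun x => a (Sum.inl x)) u :=
    (simulationGraph s).sat_trim.trans ((correct s hpair u).2 a)
  have hsub (u : V ⊕ W) : (nodeTree D Dc T u).Subtree T.modified :=
    (nodeTree_subtree_modified u).trans (hpair.dnodeY_subtree u).modified
  refine ⟨fun u hu => ⟨hsub u, (simulationGraph s).isSDD_trim (correct s hpair u).1, hsat u hu⟩,
    hT.modified, ?_, fun a => ?_⟩
  · exact (simulationGraph s).isSDD_trim ((correct s hpair (.inl D.root)).1.mono (hsub _))
  · exact (hsat (.inl D.root) .refl a).trans (hf _)
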